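/- For a finite simple graph $G$ and an integer $k\ge 1$, a set $S\subseteq V(G)$ is a $k$-quasiperfect dominating set if every vertex not in $S$ is adjacent to at least one and at most $k$ vertices of $S$; $\gamma_{1k}(G)$ denotes the minimum cardinality of such a set. Theorem. For any tree $T$ with $n$ vertices and any $k\ge 1$, $\gamma_{1k}(T)$ can be computed in linear time, where $T$ is given by a parent array. More precisely: call a numbering of the vertices of $T$ by $0,\dots,n-1$ together with an array $p$ a parent array of $T$ if $p(j)<j$ for every $1\le j\le n-1$ and the edges of $T$ are exactly the pairs of vertices numbered $j$ and $p(j)$, $1\le j\le n-1$. Every tree has a parent array. There are a single random access machine program and a constant $C$ such that for every tree $T$, every parent array $p$ of $T$ (with $n=|V(T)|$) and every integer $k\ge 1$, the program on input $(n,k,p)$ halts with output $\gamma_{1k}(T)$ after at most $C\,n$ elementary steps. Elementary steps are reading a constant or variable, array access, addition, truncated subtraction, comparison and assignment; all numbers that occur in the computation are at most $C\,(n+k)$, so that they fit in machine words of $O(\log (n+k))$ bits. -/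

import Mathlib

/-! ### Quasiperfect domination -/

/-- `S` is a `k`-quasiperfect dominating set of `G`: every vertex outside `S` is adjacent to
at least one and to at most `k` vertices of `S`. -/
def IsQuasiperfectDominating {V : Type*} (G : SimpleGraph V) (k : ℕ) (S : Set V) : Prop :=
  ∀ v, v ∉ S → (∃ u ∈ S, G.Adj v u) ∧ (G.neighborSet v ∩ S).ncard ≤ k

/-- The set of all vertices is always `k`-quasiperfect dominating. -/
theorem isQuasiperfectDominating_univ {V : Type*} (G : SimpleGraph V) (k : ℕ) :
    IsQuasiperfectDominating G k Set.univ :=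
  fun v hv => absurd (Set.mem_univ v) hv

/-- The `k`-quasiperfect domination number of a finite graph: the minimum cardinality of a
`k`-quasiperfect dominating set. -/
noncomputable def quasiperfectDominationNumber {V : Type*} [Finite V]
    (G : SimpleGraph V) (k : ℕ) : ℕ :=
  sInf {m : ℕ | ∃ S : Set V, IsQuasiperfectDominating G k S ∧ S.ncard = m}

/-- The minimum in `quasiperfectDominationNumber` is attained. -/
theorem isLeast_quasiperfectDominationNumber {V : Type*} [Finite V]
    (G : SimpleGraph V) (k : ℕ) :
    IsLeast {m : ℕ | ∃ S : Set V, IsQuasiperfectDominating G k S ∧ S.ncard = m}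
      (quasiperfectDominationNumber G k) :=
  ⟨Nat.sInf_mem ⟨_, Set.univ, isQuasiperfectDominating_univ G k, rfl⟩,
    fun _ hm => Nat.sInf_le hm⟩

/-! ### Parent arrays -/

/-- `p` is the parent array of the tree `T` for the numbering `num` of its vertices by
`0, …, n - 1`. The root is number `0`, every other vertex `j` has a parent `p j` with a smaller
number, and the edges of `T` are exactly the pairs formed by a non-root vertex and its parent.
Only the entries `p 1, …, p (n - 1)` matter. -/
def IsParentArray {V : Type*} {n : ℕ} (T : SimpleGraph V) (num : Fin n ≃ V) (p : ℕ → ℕ) :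
    Prop :=
  (∀ j : ℕ, 0 < j → j < n → p j < j) ∧
    ∀ i j : Fin n, i < j → (T.Adj (num i) (num j) ↔ p j = i)

/-! ### A random access machine with bounded words

Programs are finite texts over finitely many integer variables and arrays. Execution is
measured in elementary steps, and every number that is computed, used as an index or stored
must fit in a machine word, that is, be at most a given bound `w`; a program that exceeds the
bound is stuck and has no execution. -/

namespace RAM

/-- Expressions: constants, variables, array look-up `a[e]`, addition and truncated
subtraction. -/
inductive Expr : Type where
  | lit (m : ℕ)
  | var (x : ℕ)
  | get (a : ℕ) (e : Expr)
  | add (e₁ e₂ : Expr)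
  | sub (e₁ e₂ : Expr)

/-- Programs. The tests of `ite` and `loop` are comparisons `e₁ < e₂`. -/
inductive Prog : Type where
  | skip
  | assign (x : ℕ) (e : Expr)
  | store (a : ℕ) (i e : Expr)
  | seq (P Q : Prog)
  | ite (e₁ e₂ : Expr) (P Q : Prog)
  | loop (e₁ e₂ : Expr) (P : Prog)

/-- A memory state: the values of the variables and the contents of the arrays. -/
@[ext]
structure State : Type where
  var : ℕ → ℕ
  arr : ℕ → ℕ → ℕ

/-- `x := m` -/
def State.setVar (s : State) (x m : ℕ) : State :=
  { s with var := Function.update s.var x m }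

/-- `a[i] := m` -/
def State.setArr (s : State) (a i m : ℕ) : State :=
  { s with arr := Function.update s.arr a (Function.update (s.arr a) i m) }

/-- The value of an expression. -/
def Expr.eval (s : State) : Expr → ℕ
  | .lit m => m
  | .var x => s.var x
  | .get a e => s.arr a (e.eval s)
  | .add e₁ e₂ => e₁.eval s + e₂.eval s
  | .sub e₁ e₂ => e₁.eval s - e₂.eval s

/-- All numbers that occur in the evaluation of an expression are at most `w`. -/
def Expr.Fits (w : ℕ) (s : State) : Expr → Prop
  | .lit m => m ≤ w
  | .var x => s.var x ≤ w
  | .get a e => e.Fits w s ∧ s.arr a (e.eval s) ≤ w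
  | .add e₁ e₂ => e₁.Fits w s ∧ e₂.Fits w s ∧ e₁.eval s + e₂.eval s ≤ w
  | .sub e₁ e₂ => e₁.Fits w s ∧ e₂.Fits w s

/-- The number of elementary steps needed to evaluate an expression. -/
def Expr.cost : Expr → ℕ
  | .lit _ => 1
  | .var _ => 1
  | .get _ e => e.cost + 1
  | .add e₁ e₂ => e₁.cost + e₂.cost + 1
  | .sub e₁ e₂ => e₁.cost + e₂.cost + 1

/-- `Exec w P s t s'`: with word bound `w`, the program `P` started in state `s` halts after
exactly `t` elementary steps in state `s'`. -/
inductive Exec (w : ℕ) : Prog → State → ℕ → State → Prop where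
  | skip (s : State) : Exec w .skip s 1 s
  | assign (x : ℕ) (e : Expr) (s : State) (he : e.Fits w s) :
      Exec w (.assign x e) s (e.cost + 1) (s.setVar x (e.eval s))
  | store (a : ℕ) (i e : Expr) (s : State) (hi : i.Fits w s) (he : e.Fits w s) :
      Exec w (.store a i e) s (i.cost + e.cost + 1) (s.setArr a (i.eval s) (e.eval s))
  | seq {P Q : Prog} {s s₁ s₂ : State} {t₁ t₂ : ℕ}
      (hP : Exec w P s t₁ s₁) (hQ : Exec w Q s₁ t₂ s₂) :
      Exec w (.seq P Q) s (t₁ + t₂) s₂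
  | ite_true {e₁ e₂ : Expr} {P Q : Prog} {s s' : State} {t : ℕ}
      (h₁ : e₁.Fits w s) (h₂ : e₂.Fits w s) (h : e₁.eval s < e₂.eval s)
      (hP : Exec w P s t s') :
      Exec w (.ite e₁ e₂ P Q) s (e₁.cost + e₂.cost + 1 + t) s'
  | ite_false {e₁ e₂ : Expr} {P Q : Prog} {s s' : State} {t : ℕ}
      (h₁ : e₁.Fits w s) (h₂ : e₂.Fits w s) (h : ¬ e₁.eval s < e₂.eval s)
      (hQ : Exec w Q s t s') :
      Exec w (.ite e₁ e₂ P Q) s (e₁.cost + e₂.cost + 1 + t) s'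
  | loop_false {e₁ e₂ : Expr} {P : Prog} {s : State}
      (h₁ : e₁.Fits w s) (h₂ : e₂.Fits w s) (h : ¬ e₁.eval s < e₂.eval s) :
      Exec w (.loop e₁ e₂ P) s (e₁.cost + e₂.cost + 1) s
  | loop_true {e₁ e₂ : Expr} {P : Prog} {s s₁ s₂ : State} {t₁ t₂ : ℕ}
      (h₁ : e₁.Fits w s) (h₂ : e₂.Fits w s) (h : e₁.eval s < e₂.eval s)
      (hP : Exec w P s t₁ s₁) (hL : Exec w (.loop e₁ e₂ P) s₁ t₂ s₂) :
      Exec w (.loop e₁ e₂ P) s (e₁.cost + e₂.cost + 1 + t₁ + t₂) s₂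

/-- The initial state on input `n`, `k` and the parent array `p` of a tree on `n` vertices:
variable `0` holds `n`, variable `1` holds `k`, the cells `1, …, n - 1` of array `0` hold
`p 1, …, p (n - 1)`, and everything else is `0`. -/
def input (n k : ℕ) (p : ℕ → ℕ) : State where
  var x := if x = 0 then n else if x = 1 then k else 0
  arr a i := if a = 0 ∧ 0 < i ∧ i < n then p i else 0

/-- The output of a computation that halts in state `s` is the value of variable `0`. -/
def output (s : State) : ℕ := s.var 0

end RAM

/-!
The minimum is computed by a dynamic programme from the leaves to the root. A vertex has three
costs: `A` when it is in the set, `B` when it and its parent are outside, `D` when it is outside and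
its parent inside. `A` is one plus the sum of the `min A D` of the children. For `B` and `D` the
vertex chooses which children are in the set, between `1` and `k` of them for `B` and at most
`k - 1` for `D`. Children with `B` infinite are forced; among the others the best choice takes the
largest positive gains `B - A`, and for `B`, if nothing is gained, a child with the least loss
(`costOut_le`, `exists_subset_costOut`, `costDom_le`, `exists_subset_costDom`). That the costs of
the root give the domination number is `quasiperfectDominationNumber_eq`.

The largest gains at a vertex have to be summed without sorting by comparisons. The gains are put
into buckets, and the sum of the `j` largest is read off as the sum over the levels `i ≥ 1` of the
minimum of `j` and the number of gains that are at least `i` (`topSum`). This takes time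
proportional to the number of children plus the largest finite gain. A single gain can be as large
as the subtree, so that linear time needs an amortised bound: with the potential
`(B - min A D) + (A - B)` (truncated subtractions, and `0` if `B` is infinite), the potential of a
vertex plus its bucket range is at most the sum of the potentials of its children, up to one unit
for the vertex and for each child (`spread_add_bucketRange_le`). The reason is that a vertex which
may choose a child that is not forced realises its largest gain, and a realised gain is lost from
the potential. Hence the bucket ranges add up to at most `2 * n`
(`IsCostTable.sum_bucketRange_le`).

The program keeps, for each vertex, aggregates over its children processed so far and a linked list
of those with positive gain; its correctness and running time are
`RAM.runs_quasiperfectProg`. A parent array is obtained by numbering the vertices by their distance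
from a root (`SimpleGraph.IsTree.exists_isParentArray`).
-/

open Finset

/-! ### Selecting the largest gains -/

/-- The largest sum of at most `j` values of `g` on `C`, written as a sum over the levels `i` of
the number of selected elements whose value is at least `i`. -/
def topSum {ι : Type*} (C : Finset ι) (g : ι → ℕ) (j : ℕ) : ℕ :=
  ∑ i ∈ Icc 1 (C.sup g), min j #{c ∈ C | i ≤ g c}

theorem topSum_mono {ι : Type*} (C : Finset ι) (g : ι → ℕ) {i j : ℕ} (h : i ≤ j) :
    topSum C g i ≤ topSum C g j :=
  sum_le_sum fun _ _ => min_le_min_right _ h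

theorem topSum_zero {ι : Type*} (C : Finset ι) (g : ι → ℕ) : topSum C g 0 = 0 := by
  simp [topSum]

/-- A sum of natural numbers, counted level by level. -/
theorem sum_eq_sum_card_le {ι : Type*} (P : Finset ι) (g : ι → ℕ) (M : ℕ)
    (h : ∀ c ∈ P, g c ≤ M) : ∑ c ∈ P, g c = ∑ i ∈ Icc 1 M, #{c ∈ P | i ≤ g c} := by
  simp_rw [card_filter]
  rw [sum_comm]
  refine sum_congr rfl fun c hc => ?_
  rw [← card_filter]
  have : {i ∈ Icc 1 M | i ≤ g c} = Icc 1 (g c) := by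
    ext i
    have := h c hc
    simp only [mem_filter, mem_Icc]
    omega
  rw [this, Nat.card_Icc]
  omega

theorem sum_le_topSum {ι : Type*} {C P : Finset ι} (g : ι → ℕ) {j : ℕ} (hP : P ⊆ C)
    (hj : #P ≤ j) : ∑ c ∈ P, g c ≤ topSum C g j := by
  rw [sum_eq_sum_card_le P g (C.sup g) fun c hc => le_sup (hP hc)]
  exact sum_le_sum fun i _ => le_min ((card_filter_le _ _).trans hj)
    (card_le_card (filter_subset_filter _ hP))

theorem sup_le_topSum {ι : Type*} (C : Finset ι) (g : ι → ℕ) {j : ℕ} (hj : 1 ≤ j) :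
    C.sup g ≤ topSum C g j := by
  refine Finset.sup_le fun c hc => ?_
  have := sum_le_topSum (C := C) (P := {c}) g (j := j) (by simpa using hc) (by simpa using hj)
  simpa using this

theorem exists_top_subset {ι : Type*} (C : Finset ι) (g : ι → ℕ) (j : ℕ) :
    ∃ P ⊆ C, #P = min j #C ∧ ∀ x ∈ P, ∀ y ∈ C, y ∉ P → g y ≤ g x := by
  classical
  induction j with
  | zero => exact ⟨∅, by simp⟩
  | succ j ih =>
    obtain ⟨P, hPC, hcard, hP⟩ := ih
    by_cases hne : (C \ P).Nonempty
    · obtain ⟨z, hz, hmax⟩ := exists_max_image (C \ P) g hne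
      rw [mem_sdiff] at hz
      have hlt : #P < #C := card_lt_card ⟨hPC, fun h => hz.2 (h hz.1)⟩
      refine ⟨insert z P, insert_subset hz.1 hPC, ?_, ?_⟩
      · rw [card_insert_of_notMem hz.2]
        omega
      · intro x hx y hy hyP
        rw [mem_insert, not_or] at hyP
        rcases mem_insert.1 hx with rfl | hx
        · exact hmax y (mem_sdiff.2 ⟨hy, hyP.2⟩)
        · exact hP x hx y hy hyP.2
    · have : C ⊆ P := by rwa [not_nonempty_iff_eq_empty, sdiff_eq_empty_iff_subset] at hne
      obtain rfl := subset_antisymm hPC this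
      exact ⟨P, hPC, by omega, hP⟩

/-- `topSum` is attained. A set of `j` elements with the largest values realises the minimum on
every level at once. -/
theorem exists_sum_eq_topSum {ι : Type*} (C : Finset ι) (g : ι → ℕ) (j : ℕ) :
    ∃ P ⊆ C, #P ≤ j ∧ (∀ c ∈ P, 0 < g c) ∧ ∑ c ∈ P, g c = topSum C g j := by
  obtain ⟨P, hPC, hcard, hP⟩ := exists_top_subset C g j
  refine ⟨{c ∈ P | 0 < g c}, (filter_subset _ _).trans hPC,
    (card_filter_le _ _).trans (by omega), by simp, ?_⟩
  have h0 : ∑ c ∈ P with 0 < g c, g c = ∑ c ∈ P, g c := by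
    refine sum_subset (filter_subset _ _) fun x hx hx' => ?_
    simp only [mem_filter, not_and, not_lt] at hx'
    exact Nat.le_zero.1 (hx' hx)
  rw [h0, sum_eq_sum_card_le P g (C.sup g) fun c hc => le_sup (hPC hc)]
  refine sum_congr rfl fun i _ => ?_
  have hle : #{c ∈ P | i ≤ g c} ≤ #{c ∈ C | i ≤ g c} := card_le_card (filter_subset_filter _ hPC)
  by_cases hex : ∃ y ∈ C, y ∉ P ∧ i ≤ g y
  · obtain ⟨y, hy, hyP, hi⟩ := hex
    have hlt : #P < #C := card_lt_card ⟨hPC, fun h => hyP (h hy)⟩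
    have : {c ∈ P | i ≤ g c} = P := filter_true_of_mem fun x hx => hi.trans (hP x hx y hy hyP)
    rw [this] at hle ⊢
    omega
  · push Not at hex
    have : {c ∈ C | i ≤ g c} = {c ∈ P | i ≤ g c} := by
      ext c
      simp only [mem_filter]
      refine ⟨fun h => ⟨?_, h.2⟩, fun h => ⟨hPC h.1, h.2⟩⟩
      by_contra hc
      have := hex c h.1 hc
      omega
    rw [this]
    have := card_filter_le P fun c => i ≤ g c
    omega

/-! ### One step of the dynamic programme -/

/-- What choosing a child saves compared with leaving it out; only children that can be left out
(`b c < N`) count. -/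
def gain (N : ℕ) (a b : ℕ → ℕ) (c : ℕ) : ℕ := if b c < N then b c - a c else 0

/-- The cost of the children when exactly those that cannot be left out are chosen. -/
def baseCost (N : ℕ) (a b : ℕ → ℕ) (C : Finset ℕ) : ℕ :=
  ∑ c ∈ C, if b c < N then b c else a c

/-- The number of children that cannot be left out. -/
def numForced (N : ℕ) (b : ℕ → ℕ) (C : Finset ℕ) : ℕ := #{c ∈ C | ¬ b c < N}

/-- `N` minus the smallest extra cost `a c - b c` of choosing one child, and `0` if there is no
child. -/
def slack (N : ℕ) (a b : ℕ → ℕ) (C : Finset ℕ) : ℕ := C.sup fun c => N - (a c - b c)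

/-- The cost of a vertex in the set. -/
def costIn (a d : ℕ → ℕ) (C : Finset ℕ) : ℕ := 1 + ∑ c ∈ C, min (a c) (d c)

/-- The cost of a vertex outside the set whose parent is outside too: between one and `k` children
are chosen. The value is `N` if this is impossible. -/
def costOut (N k : ℕ) (a b : ℕ → ℕ) (C : Finset ℕ) : ℕ :=
  if k < numForced N b C then N
  else baseCost N a b C - topSum C (gain N a b) (k - numForced N b C) + (N - slack N a b C)

/-- The cost of a vertex outside the set whose parent is in the set: fewer than `k` children are
chosen. The value is `N` if this is impossible. -/
def costDom (N k : ℕ) (a b : ℕ → ℕ) (C : Finset ℕ) : ℕ :=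
  if numForced N b C < k then
    baseCost N a b C - topSum C (gain N a b) (k - numForced N b C - 1)
  else N

section Step

variable {N k : ℕ} {a b d : ℕ → ℕ} {C : Finset ℕ}

theorem topSum_gain_le_baseCost (j : ℕ) : topSum C (gain N a b) j ≤ baseCost N a b C := by
  obtain ⟨P, hPC, -, -, hsum⟩ := exists_sum_eq_topSum C (gain N a b) j
  rw [← hsum]
  refine (sum_le_sum_of_subset hPC).trans (sum_le_sum fun c _ => ?_)
  unfold gain
  split_ifs <;> omega

/-- Choosing the set `P` of children saves at most the `topSum` of the gains compared with the base
cost. -/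
theorem baseCost_le_of_subset {P : Finset ℕ} {m : ℕ} (hP : P ⊆ C)
    (hfin : ∀ c ∈ C, c ∉ P → b c < N) (hm : #P ≤ m) :
    numForced N b C ≤ m ∧ baseCost N a b C ≤
      ∑ c ∈ C, (if c ∈ P then a c else b c) + topSum C (gain N a b) (m - numForced N b C) := by
  have hsub : {c ∈ C | ¬ b c < N} ⊆ P := fun c hc => by
    rw [mem_filter] at hc
    by_contra h
    exact hc.2 (hfin c hc.1 h)
  have hI : numForced N b C ≤ #P := card_le_card hsub
  refine ⟨hI.trans hm, ?_⟩
  have h1 : ∑ c ∈ P \ {c ∈ C | ¬ b c < N}, gain N a b c ≤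
      topSum C (gain N a b) (m - numForced N b C) := by
    refine sum_le_topSum _ (sdiff_subset.trans hP) ?_
    rw [card_sdiff_of_subset hsub]
    unfold numForced at *
    omega
  have h2 : ∑ c ∈ C, (if c ∈ P \ {c ∈ C | ¬ b c < N} then gain N a b c else 0) =
      ∑ c ∈ P \ {c ∈ C | ¬ b c < N}, gain N a b c := by
    rw [sum_ite_mem, inter_eq_right.2 (sdiff_subset.trans hP)]
  refine le_trans ?_ (Nat.add_le_add_left h1 _)
  rw [← h2, ← sum_add_distrib]
  refine sum_le_sum fun c hc => ?_
  have := hfin c hc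
  unfold gain
  simp only [mem_sdiff, mem_filter, hc, true_and, not_not]
  split_ifs <;> first | omega | tauto

theorem slack_le : slack N a b C ≤ N :=
  Finset.sup_le fun _ _ => by omega

theorem slack_eq_of_le {c : ℕ} (hc : c ∈ C) (h : a c ≤ b c) : slack N a b C = N :=
  le_antisymm (Finset.sup_le fun _ _ => by omega)
    ((by omega : N ≤ N - (a c - b c)).trans (le_sup (f := fun c => N - (a c - b c)) hc))

theorem le_slack {c : ℕ} (hc : c ∈ C) : N ≤ slack N a b C + (a c - b c) := by
  have := le_sup (f := fun c => N - (a c - b c)) hc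
  unfold slack
  omega

/-- If every child is cheaper when left out, nothing is forced and nothing is gained. -/
theorem gain_eq_zero_of_lt (h : ∀ c ∈ C, b c < a c) (ha : ∀ c ∈ C, a c < N) :
    numForced N b C = 0 ∧ (∀ j, topSum C (gain N a b) j = 0) ∧
      baseCost N a b C = ∑ c ∈ C, b c ∧ C.sup (gain N a b) = 0 := by
  have hg : ∀ c ∈ C, gain N a b c = 0 := fun c hc => by
    have := h c hc
    unfold gain
    split_ifs <;> omega
  have hs : C.sup (gain N a b) = 0 := Nat.le_zero.1 (Finset.sup_le fun c hc => (hg c hc).le)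
  refine ⟨?_, fun j => ?_, ?_, hs⟩
  · rw [numForced, card_eq_zero, filter_eq_empty_iff]
    intro c hc
    have := h c hc
    have := ha c hc
    omega
  · simp [topSum, hs]
  · refine sum_congr rfl fun c hc => if_pos ?_
    have := h c hc
    have := ha c hc
    omega

theorem costDom_le {P : Finset ℕ} (hP : P ⊆ C) (hfin : ∀ c ∈ C, c ∉ P → b c < N)
    (hk : #P < k) : costDom N k a b C ≤ ∑ c ∈ C, if c ∈ P then a c else b c := by
  obtain ⟨h1, h2⟩ := baseCost_le_of_subset (a := a) (m := k - 1) hP hfin (by omega)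
  rw [costDom, if_pos (by omega)]
  rw [show k - 1 - numForced N b C = k - numForced N b C - 1 by omega] at h2
  omega

theorem costOut_le {P : Finset ℕ} (ha : ∀ c ∈ C, a c < N) (hP : P ⊆ C)
    (hfin : ∀ c ∈ C, c ∉ P → b c < N) (hne : P.Nonempty) (hk : #P ≤ k) :
    costOut N k a b C ≤ ∑ c ∈ C, if c ∈ P then a c else b c := by
  obtain ⟨h1, h2⟩ := baseCost_le_of_subset (a := a) hP hfin hk
  rw [costOut, if_neg (by omega)]
  by_cases h : ∃ c ∈ C, a c ≤ b c
  · obtain ⟨c, hc, hab⟩ := h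
    rw [slack_eq_of_le hc hab]
    omega
  · push Not at h
    obtain ⟨-, hT, hS, -⟩ := gain_eq_zero_of_lt h ha
    obtain ⟨x, hx⟩ := hne
    have h3 := le_slack (N := N) (a := a) (b := b) (hP hx)
    have h4 : ∑ c ∈ C, b c + (a x - b x) ≤ ∑ c ∈ C, if c ∈ P then a c else b c := by
      rw [← add_sum_erase _ _ (hP hx), ← add_sum_erase _ _ (hP hx), if_pos hx]
      have h5 : ∑ c ∈ C.erase x, b c ≤ ∑ c ∈ C.erase x, if c ∈ P then a c else b c := by
        refine sum_le_sum fun c hc => ?_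
        have := h c (mem_of_mem_erase hc)
        split_ifs <;> omega
      have := h x (hP hx)
      omega
    rw [hT, hS]
    omega

/-- The best choice of at most `m` children: the forced ones and those with the largest gains. If
it is empty, nothing is forced and nothing is gained. -/
theorem exists_subset_baseCost {m : ℕ} (hm : numForced N b C ≤ m) :
    ∃ P ⊆ C, (∀ c ∈ C, c ∉ P → b c < N) ∧ #P ≤ m ∧
      ∑ c ∈ C, (if c ∈ P then a c else b c) =
        baseCost N a b C - topSum C (gain N a b) (m - numForced N b C) ∧
      (P = ∅ → ∀ c ∈ C, b c < N ∧ topSum C (gain N a b) (m - numForced N b C) = 0) := by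
  obtain ⟨Q, hQC, hQ, hpos, hsum⟩ :=
    exists_sum_eq_topSum C (gain N a b) (m - numForced N b C)
  have hpos' : ∀ c ∈ Q, a c < b c ∧ b c < N := fun c hc => by
    have := hpos c hc
    unfold gain at this
    split_ifs at this <;> omega
  refine ⟨{c ∈ C | ¬ b c < N} ∪ Q, union_subset (filter_subset _ _) hQC, ?_, ?_, ?_, ?_⟩
  · intro c hc h
    simp only [mem_union, mem_filter, hc, true_and, not_or, not_not] at h
    exact h.1
  · refine (card_union_le _ _).trans ?_
    unfold numForced at *
    omega
  · have h2 : ∑ c ∈ C, (if c ∈ Q then gain N a b c else 0) = ∑ c ∈ Q, gain N a b c := by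
      rw [sum_ite_mem, inter_eq_right.2 hQC]
    rw [← hsum, ← h2]
    refine Nat.eq_sub_of_add_eq ?_
    rw [← sum_add_distrib]
    refine sum_congr rfl fun c hc => ?_
    have := hpos' c
    unfold gain
    simp only [mem_union, mem_filter, hc, true_and]
    by_cases hQ : c ∈ Q
    · have := this hQ
      simp only [hQ, or_true, if_true, this.2]
      omega
    · by_cases hb : b c < N <;> simp [hQ, hb]
  · intro h c hc
    rw [union_eq_empty] at h
    refine ⟨?_, by rw [← hsum, h.2, sum_empty]⟩
    have := filter_eq_empty_iff.1 h.1 hc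
    simpa using this

theorem exists_subset_costDom (h : costDom N k a b C < N) :
    ∃ P ⊆ C, (∀ c ∈ C, c ∉ P → b c < N) ∧ #P < k ∧
      ∑ c ∈ C, (if c ∈ P then a c else b c) = costDom N k a b C := by
  unfold costDom at h ⊢
  split_ifs at h ⊢ with hk
  · obtain ⟨P, hP, hfin, hcard, hsum, -⟩ :=
      exists_subset_baseCost (N := N) (a := a) (b := b) (C := C) (m := k - 1) (by omega)
    refine ⟨P, hP, hfin, by omega, ?_⟩
    rw [hsum, show k - 1 - numForced N b C = k - numForced N b C - 1 by omega]
  · omega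

theorem exists_subset_costOut (hk : 1 ≤ k) (ha : ∀ c ∈ C, a c < N) (hne : C.Nonempty)
    (h : numForced N b C ≤ k) :
    ∃ P ⊆ C, (∀ c ∈ C, c ∉ P → b c < N) ∧ P.Nonempty ∧ #P ≤ k ∧
      ∑ c ∈ C, (if c ∈ P then a c else b c) = costOut N k a b C := by
  rw [costOut, if_neg (by omega)]
  obtain ⟨P, hP, hfin, hcard, hsum, hemp⟩ :=
    exists_subset_baseCost (N := N) (a := a) (b := b) (C := C) h
  -- With a child that is no cheaper when left out the greedy choice can be made nonempty for free.
  by_cases hlt : ∀ c ∈ C, b c < a c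
  · obtain ⟨hI, hT, hS, -⟩ := gain_eq_zero_of_lt hlt ha
    obtain ⟨x, hx, hmax⟩ := exists_mem_eq_sup C hne fun c => N - (a c - b c)
    refine ⟨{x}, by simpa using hx, fun c hc _ => (hlt c hc).trans (ha c hc), by simp,
      by simpa using hk, ?_⟩
    rw [hT, hS, slack, hmax, ← add_sum_erase _ _ hx, ← add_sum_erase _ _ hx]
    have : ∑ c ∈ C.erase x, (if c ∈ ({x} : Finset ℕ) then a c else b c) =
        ∑ c ∈ C.erase x, b c :=
      sum_congr rfl fun c hc => if_neg (by simpa using ne_of_mem_erase hc)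
    rw [this, if_pos (by simp)]
    have := hlt x hx
    have := ha x hx
    omega
  · push Not at hlt
    obtain ⟨x, hx, hab⟩ := hlt
    rw [slack_eq_of_le hx hab, Nat.sub_self, add_zero]
    rcases P.eq_empty_or_nonempty with rfl | hPne
    · have hT := fun c hc => (hemp rfl c hc)
      have hI : numForced N b C = 0 := by
        rw [numForced, card_eq_zero, filter_eq_empty_iff]
        exact fun c hc => by simpa using (hT c hc).1
      have hle : gain N a b x ≤ topSum C (gain N a b) (k - numForced N b C) :=
        (le_sup hx).trans (sup_le_topSum _ _ (by omega))
      rw [(hT x hx).2, gain, if_pos (hT x hx).1] at hle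
      refine ⟨{x}, by simpa using hx, fun c hc _ => (hT c hc).1, by simp, by simpa using hk, ?_⟩
      rw [← hsum]
      refine sum_congr rfl fun c hc => ?_
      by_cases hcx : c = x
      · subst hcx
        simp
        omega
      · simp [hcx]
    · exact ⟨P, hP, hfin, hPne, hcard, hsum⟩

/-! ### The potential bounding the bucket ranges -/

/-- The spread of the three costs of a vertex that can be left out. -/
def spread (N a b d : ℕ) : ℕ := if b < N then (b - min a d) + (a - b) else 0

/-- The range of the buckets used at a vertex. They are used only if some child that is not forced
may be chosen. -/
def bucketRange (N k : ℕ) (a b : ℕ → ℕ) (C : Finset ℕ) : ℕ :=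
  if numForced N b C < k then C.sup (gain N a b) else 0

theorem gain_le_spread (c : ℕ) : gain N a b c ≤ spread N (a c) (b c) (d c) := by
  unfold gain spread
  split_ifs <;> omega

/-- The bucket range at a vertex is paid for by a loss of spread, up to one unit for the vertex and
one for each child. When the buckets are used, the largest gains are realised, so that they
disappear from the spread of the vertex. -/
theorem spread_add_bucketRange_le (hk : 1 ≤ k) (ha : ∀ c ∈ C, a c < N)
    (hleaf : ∀ c ∈ C, N ≤ b c → a c ≤ d c + 1) :
    spread N (costIn a d C) (costOut N k a b C) (costDom N k a b C) + bucketRange N k a b C ≤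
      1 + ∑ c ∈ C, (1 + spread N (a c) (b c) (d c)) := by
  have hMle : bucketRange N k a b C ≤ ∑ c ∈ C, spread N (a c) (b c) (d c) := by
    unfold bucketRange
    split_ifs
    · exact Finset.sup_le fun c hc => (gain_le_spread c).trans
        (single_le_sum (f := fun c => spread N (a c) (b c) (d c)) (fun _ _ => Nat.zero_le _) hc)
    · exact Nat.zero_le _
  have hsum1 : ∑ c ∈ C, (1 + spread N (a c) (b c) (d c)) =
      #C + ∑ c ∈ C, spread N (a c) (b c) (d c) := by
    rw [sum_add_distrib, sum_const, smul_eq_mul, mul_one]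
  by_cases hB : costOut N k a b C < N
  swap
  · rw [spread, if_neg hB]
    omega
  have hI : ¬ k < numForced N b C := fun h => by
    rw [costOut, if_pos h] at hB
    omega
  rw [costOut, if_neg hI] at hB
  have hBval : costOut N k a b C = baseCost N a b C -
      topSum C (gain N a b) (k - numForced N b C) + (N - slack N a b C) := by
    rw [costOut, if_neg hI]
  by_cases hlt : ∀ c ∈ C, b c < a c
  · obtain ⟨hI0, hT, hS, hsup⟩ := gain_eq_zero_of_lt hlt ha
    have hne : C.Nonempty := by
      by_contra h
      rw [not_nonempty_iff_eq_empty] at h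
      subst h
      simp [slack] at hB
    obtain ⟨x, hx, hmax⟩ := exists_mem_eq_sup C hne fun c => N - (a c - b c)
    have hM : bucketRange N k a b C = 0 := by simp [bucketRange, hsup]
    have hD : costDom N k a b C = ∑ c ∈ C, b c := by
      rw [costDom, if_pos (by omega), hT, hS, Nat.sub_zero]
    have hB' : costOut N k a b C = ∑ c ∈ C, b c + (a x - b x) := by
      have := ha x hx
      rw [hBval, hT, hS, slack, hmax]
      omega
    have hsp : ∀ c ∈ C, spread N (a c) (b c) (d c) = (b c - min (a c) (d c)) + (a c - b c) :=
      fun c hc => if_pos ((hlt c hc).trans (ha c hc))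
    -- No gain is positive, so that no buckets are needed. The least loss `a x - b x` enters the
    -- cost `B`, but it is contained in the spread of `x`.
    have hx1 : a x - b x ≤ ∑ c ∈ C, (a c - b c) :=
      single_le_sum (f := fun c => a c - b c) (fun _ _ => Nat.zero_le _) hx
    have h1 : ∑ c ∈ C, spread N (a c) (b c) (d c) =
        ∑ c ∈ C, (b c - min (a c) (d c)) + ∑ c ∈ C, (a c - b c) := by
      rw [← sum_add_distrib]
      exact sum_congr rfl hsp
    have h2 : ∑ c ∈ C, b c ≤ ∑ c ∈ C, min (a c) (d c) + ∑ c ∈ C, (b c - min (a c) (d c)) := by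
      rw [← sum_add_distrib]
      exact sum_le_sum fun c _ => by omega
    have h3 : ∑ c ∈ C, min (a c) (d c) ≤ ∑ c ∈ C, b c + ∑ c ∈ C, (a c - b c) := by
      rw [← sum_add_distrib]
      exact sum_le_sum fun c _ => by omega
    rw [spread, hM, hD, hB', costIn, hsum1]
    split_ifs <;> omega
  · push Not at hlt
    obtain ⟨x, hx, hab⟩ := hlt
    rw [slack_eq_of_le hx hab, Nat.sub_self, add_zero] at hBval
    have hTS := topSum_gain_le_baseCost (N := N) (a := a) (b := b) (C := C) (k - numForced N b C)
    have hMT : bucketRange N k a b C ≤ topSum C (gain N a b) (k - numForced N b C) := by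
      unfold bucketRange
      split_ifs
      · exact sup_le_topSum _ _ (by omega)
      · exact Nat.zero_le _
    have hDB : costOut N k a b C ≤ costDom N k a b C := by
      rw [costDom]
      split_ifs with h
      · have := topSum_mono C (gain N a b) (Nat.sub_le (k - numForced N b C) 1)
        omega
      · rw [hBval]
        omega
    -- A forced child has no spread; its choice costs at most one more than `min (a c) (d c)`.
    have h1 : baseCost N a b C ≤
        ∑ c ∈ C, min (a c) (d c) + ∑ c ∈ C, (1 + spread N (a c) (b c) (d c)) := by
      rw [← sum_add_distrib]
      refine sum_le_sum fun c hc => ?_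
      have := hleaf c hc
      unfold spread
      split_ifs <;> omega
    -- The chosen gains occur twice on the left: as savings and as a bound for the range.
    have h2 : ∑ c ∈ C, min (a c) (d c) + 2 * topSum C (gain N a b) (k - numForced N b C) ≤
        baseCost N a b C + ∑ c ∈ C, spread N (a c) (b c) (d c) := by
      obtain ⟨P, hPC, -, hpos, hsum⟩ :=
        exists_sum_eq_topSum C (gain N a b) (k - numForced N b C)
      have h3 : ∑ c ∈ C, (if c ∈ P then gain N a b c else 0) = ∑ c ∈ P, gain N a b c := by
        rw [sum_ite_mem, inter_eq_right.2 hPC]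
      rw [← hsum, ← h3, mul_sum, baseCost, ← sum_add_distrib, ← sum_add_distrib]
      refine sum_le_sum fun c hc => ?_
      have := hpos c
      unfold gain at this ⊢
      unfold spread
      split_ifs at this ⊢ <;> omega
    have hAdef : costIn a d C = 1 + ∑ c ∈ C, min (a c) (d c) := rfl
    rw [spread, hsum1]
    split_ifs <;> omega

end Step

/-! ### Parent arrays of trees -/

/-- In a tree with a root `r`, a vertex has at most one neighbour closer to `r`. -/
theorem SimpleGraph.IsTree.eq_of_adj_of_dist_lt {V : Type*} {T : SimpleGraph V} (hT : T.IsTree)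
    {r v w w' : V} (hw : T.Adj v w) (hw' : T.Adj v w') (hd : T.dist r w < T.dist r v)
    (hd' : T.dist r w' < T.dist r v) : w = w' := by
  classical
  obtain ⟨p, hp, -⟩ := hT.connected.exists_path_of_dist r v
  have key : ∀ u, T.Adj v u → T.dist r u < T.dist r v → u = p.penultimate := by
    intro u hu hd
    obtain ⟨q, hq, hlen⟩ := hT.connected.exists_path_of_dist r u
    refine hT.isAcyclic.eq_penultimate_of_adj_end hp hu
      (hT.isAcyclic.mem_support_of_ne_mem_support_of_adj_of_isPath hp hq hu fun hv => ?_)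
    have h1 := SimpleGraph.dist_le (q.takeUntil v hv)
    have h2 := q.length_takeUntil_le_length hv
    omega
  rw [key w hw hd, key w' hw' hd']

theorem SimpleGraph.Connected.exists_adj_dist_lt {V : Type*} {T : SimpleGraph V}
    (hT : T.Connected) {r v : V} (hv : v ≠ r) : ∃ w, T.Adj v w ∧ T.dist r w < T.dist r v := by
  obtain ⟨p, hp⟩ := hT.exists_walk_length_eq_dist v r
  cases p with
  | nil => exact absurd rfl hv
  | cons h q =>
    refine ⟨_, h, ?_⟩
    rw [SimpleGraph.dist_comm, SimpleGraph.dist_comm (u := r), ← hp, SimpleGraph.Walk.length_cons]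
    exact Nat.lt_succ_of_le (SimpleGraph.dist_le q)

/-- Numbering the vertices by increasing distance from a root gives a parent array. -/
theorem SimpleGraph.IsTree.exists_isParentArray {V : Type*} [Finite V] {T : SimpleGraph V}
    (hT : T.IsTree) : ∃ (num : Fin (Nat.card V) ≃ V) (p : ℕ → ℕ), IsParentArray T num p := by
  classical
  obtain ⟨r⟩ := hT.connected.nonempty
  let e : Fin (Nat.card V) ≃ V := (Finite.equivFin V).symm
  let f : Fin (Nat.card V) → ℕ := fun i => T.dist r (e i)
  let num : Fin (Nat.card V) ≃ V := (Tuple.sort f).trans e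
  have hmono : ∀ i j, i ≤ j → T.dist r (num i) ≤ T.dist r (num j) :=
    fun i j h => Tuple.monotone_sort f h
  have hroot : ∀ j : Fin (Nat.card V), 0 < j.1 → num j ≠ r := by
    intro j hj hr
    have h0 := hmono ⟨0, by omega⟩ j (Nat.zero_le _)
    rw [hr, SimpleGraph.dist_self] at h0
    have h1 := hT.connected.dist_eq_zero_iff.1 (Nat.le_zero.1 h0)
    have h2 := congrArg Fin.val (num.injective (h1.symm.trans hr.symm))
    simp at h2
    omega
  have hpar : ∀ j : Fin (Nat.card V), 0 < j.1 →
      ∃ i, T.Adj (num j) (num i) ∧ T.dist r (num i) < T.dist r (num j) := by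
    intro j hj
    obtain ⟨w, hw, hd⟩ := hT.connected.exists_adj_dist_lt (hroot j hj)
    exact ⟨num.symm w, by simpa using hw, by simpa using hd⟩
  let p : ℕ → ℕ := fun j => if h : ∃ hj : j < Nat.card V, 0 < j then
    (hpar ⟨j, h.1⟩ h.2).choose else 0
  have hp : ∀ j : Fin (Nat.card V), 0 < j.1 → ∃ i : Fin (Nat.card V), p j = i ∧
      T.Adj (num j) (num i) ∧ T.dist r (num i) < T.dist r (num j) := fun j hj =>
    ⟨(hpar j hj).choose, dif_pos ⟨j.2, hj⟩, (hpar j hj).choose_spec⟩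
  refine ⟨num, p, fun j hj hjn => ?_, fun i j hij => ?_⟩
  · obtain ⟨i, hi, -, hd⟩ := hp ⟨j, hjn⟩ hj
    change p j = i at hi
    rw [hi]
    by_contra h
    exact absurd (hmono ⟨j, hjn⟩ i (not_lt.1 h)) (not_le.2 hd)
  · obtain ⟨x, hx, hadj, hd⟩ := hp j (lt_of_le_of_lt (Nat.zero_le _) hij)
    rw [hx]
    constructor
    · intro h
      have h1 := hmono i j hij.le
      have h2 := hT.dist_ne_of_adj r h
      rw [num.injective (hT.eq_of_adj_of_dist_lt hadj h.symm hd (lt_of_le_of_ne h1 h2))]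
    · intro h
      rw [Fin.val_injective h] at hadj
      exact hadj.symm

/-! ### Recursion along a parent array -/

/-- The children of the vertex number `v`. -/
def children (n : ℕ) (p : ℕ → ℕ) (v : ℕ) : Finset ℕ := {c ∈ Ico (v + 1) n | p c = v}

theorem mem_children {n : ℕ} {p : ℕ → ℕ} {v c : ℕ} :
    c ∈ children n p v ↔ v < c ∧ c < n ∧ p c = v := by
  simp [children, and_assoc]

/-- Recursion from the leaves to the root. -/
theorem exists_downward_rec {α : Type*} [Nonempty α] (n : ℕ) (F : ℕ → (ℕ → α) → α)
    (hF : ∀ v f g, (∀ c, v < c → c < n → f c = g c) → F v f = F v g) :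
    ∃ f : ℕ → α, ∀ v < n, f v = F v f := by
  suffices h : ∀ m, ∃ f : ℕ → α, ∀ v < n, n ≤ v + m → f v = F v f by
    obtain ⟨f, hf⟩ := h n
    exact ⟨f, fun v hv => hf v hv (by omega)⟩
  intro m
  induction m with
  | zero => exact ⟨fun _ => Classical.arbitrary α, fun v hv h => by omega⟩
  | succ m ih =>
    obtain ⟨f, hf⟩ := ih
    refine ⟨fun v => if n ≤ v + m then f v else F v f, fun v hv h => ?_⟩
    have hg : F v (fun v => if n ≤ v + m then f v else F v f) = F v f :=
      hF v _ _ fun c hc hcn => if_pos (by omega)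
    rw [hg]
    dsimp only
    split_ifs with h'
    · exact hf v hv h'
    · rfl

/-- Recursion from the root to the leaves. -/
theorem exists_upward_rec {α : Type*} (n : ℕ) (p : ℕ → ℕ) (hp : ∀ j, 0 < j → j < n → p j < j)
    (x : α) (F : ℕ → α → α) :
    ∃ f : ℕ → α, f 0 = x ∧ ∀ v, 0 < v → v < n → f v = F v (f (p v)) := by
  suffices h : ∀ m, ∃ f : ℕ → α, f 0 = x ∧ ∀ v, 0 < v → v < n → v ≤ m → f v = F v (f (p v)) by
    obtain ⟨f, h0, hf⟩ := h n
    exact ⟨f, h0, fun v h0 hv => hf v h0 hv hv.le⟩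
  intro m
  induction m with
  | zero => exact ⟨fun _ => x, rfl, fun v hv _ h => by omega⟩
  | succ m ih =>
    obtain ⟨f, h0, hf⟩ := ih
    refine ⟨fun v => if v ≤ m then f v else F v (f (p v)), by simpa using h0,
      fun v hv hvn h => ?_⟩
    have := hp v hv hvn
    dsimp only
    rw [if_pos (by omega : p v ≤ m)]
    split_ifs with h'
    · exact hf v hv hvn h'
    · rfl

theorem sum_sum_children {n : ℕ} {p : ℕ → ℕ} (hp : ∀ j, 0 < j → j < n → p j < j) (f : ℕ → ℕ) :
    ∑ v ∈ range n, ∑ c ∈ children n p v, f c = ∑ c ∈ Ico 1 n, f c := by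
  have hmaps : ∀ c ∈ Ico 1 n, p c ∈ range n := fun c hc => by
    rw [mem_Ico] at hc
    have := hp c (by omega) hc.2
    rw [mem_range]
    omega
  rw [← sum_fiberwise_of_maps_to hmaps]
  refine sum_congr rfl fun v _ => sum_congr ?_ fun _ _ => rfl
  ext c
  rw [mem_children, mem_filter, mem_Ico]
  constructor
  · rintro ⟨h1, h2, h3⟩
    exact ⟨⟨by omega, h2⟩, h3⟩
  · rintro ⟨⟨h1, h2⟩, h3⟩
    have := hp c (by omega) h2
    exact ⟨by omega, h2, h3⟩

/-- The weights of the subtrees for a vertex weight `w`. -/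
theorem exists_subtree_sum (n : ℕ) (p : ℕ → ℕ) (w : ℕ → ℕ) :
    ∃ f : ℕ → ℕ, ∀ v < n, f v = w v + ∑ c ∈ children n p v, f c :=
  exists_downward_rec n (fun v f => w v + ∑ c ∈ children n p v, f c) fun v f g h => by
    refine congrArg _ (sum_congr rfl fun c hc => ?_)
    rw [mem_children] at hc
    exact h c hc.1 hc.2.1

theorem subtree_sum_root {n : ℕ} {p w f : ℕ → ℕ} (hn : 0 < n)
    (hp : ∀ j, 0 < j → j < n → p j < j)
    (hf : ∀ v < n, f v = w v + ∑ c ∈ children n p v, f c) : f 0 = ∑ v ∈ range n, w v := by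
  have h1 : ∑ v ∈ range n, f v = ∑ v ∈ range n, w v + ∑ c ∈ Ico 1 n, f c := by
    rw [← sum_sum_children hp, ← sum_add_distrib]
    exact sum_congr rfl fun v hv => hf v (mem_range.1 hv)
  rw [range_eq_Ico, sum_eq_sum_Ico_succ_bot hn, zero_add] at h1
  rw [range_eq_Ico]
  omega

theorem subtree_sum_le {n : ℕ} {p w f : ℕ → ℕ} (hp : ∀ j, 0 < j → j < n → p j < j)
    (hf : ∀ v < n, f v = w v + ∑ c ∈ children n p v, f c) :
    ∀ v < n, f v ≤ ∑ v ∈ range n, w v := by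
  intro v
  induction v using Nat.strong_induction_on with
  | _ v ih =>
    intro hv
    rcases Nat.eq_zero_or_pos v with rfl | h0
    · exact (subtree_sum_root hv hp hf).le
    · have hlt := hp v h0 hv
      refine le_trans ?_ (ih (p v) hlt (hlt.trans hv))
      rw [hf (p v) (hlt.trans hv)]
      have : f v ≤ ∑ c ∈ children n p (p v), f c :=
        single_le_sum (fun _ _ => Nat.zero_le _) (mem_children.2 ⟨hlt, hv, rfl⟩)
      omega

theorem downward_induction {n : ℕ} {p : ℕ → ℕ} {Q : ℕ → Prop}
    (h : ∀ v < n, (∀ c ∈ children n p v, Q c) → Q v) : ∀ v < n, Q v := by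
  suffices H : ∀ m, ∀ v < n, n ≤ v + m → Q v from fun v hv => H n v hv (by omega)
  intro m
  induction m with
  | zero => intro v hv h; omega
  | succ m ih =>
    intro v hv hm
    refine h v hv fun c hc => ?_
    rw [mem_children] at hc
    exact ih c hc.2.1 (by omega)

/-! ### The dynamic programme -/

/-- `A v`, `B v`, `D v` are the least costs of the subtree of `v` when `v` is in the set, when `v`
and its parent are outside it, and when `v` is outside it and its parent inside. The number
`n + 1` stands for infinity. -/
structure IsCostTable (n k : ℕ) (p A B D : ℕ → ℕ) : Prop where
  eq_in : ∀ v < n, A v = costIn A D (children n p v)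
  eq_out : ∀ v < n, B v = costOut (n + 1) k A B (children n p v)
  eq_dom : ∀ v < n, D v = costDom (n + 1) k A B (children n p v)

theorem exists_isCostTable (n k : ℕ) (p : ℕ → ℕ) : ∃ A B D, IsCostTable n k p A B D := by
  obtain ⟨f, hf⟩ := exists_downward_rec (α := ℕ × ℕ × ℕ) n
    (fun v f => (costIn (fun c => (f c).1) (fun c => (f c).2.2) (children n p v),
      costOut (n + 1) k (fun c => (f c).1) (fun c => (f c).2.1) (children n p v),
      costDom (n + 1) k (fun c => (f c).1) (fun c => (f c).2.1) (children n p v)))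
    (by
      intro v f g h
      have h' : ∀ c ∈ children n p v, f c = g c := fun c hc => by
        rw [mem_children] at hc
        exact h c hc.1 hc.2.1
      have hgain : ∀ c ∈ children n p v,
          gain (n + 1) (fun c => (f c).1) (fun c => (f c).2.1) c =
          gain (n + 1) (fun c => (g c).1) (fun c => (g c).2.1) c := fun c hc => by
        simp only [gain, h' c hc]
      have hin : costIn (fun c => (f c).1) (fun c => (f c).2.2) (children n p v) =
          costIn (fun c => (g c).1) (fun c => (g c).2.2) (children n p v) :=
        congrArg _ (sum_congr rfl fun c hc => by simp only [h' c hc])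
      have hI : numForced (n + 1) (fun c => (f c).2.1) (children n p v) =
          numForced (n + 1) (fun c => (g c).2.1) (children n p v) :=
        congrArg Finset.card (filter_congr fun c hc => by simp [h' c hc])
      have hS : baseCost (n + 1) (fun c => (f c).1) (fun c => (f c).2.1) (children n p v) =
          baseCost (n + 1) (fun c => (g c).1) (fun c => (g c).2.1) (children n p v) :=
        sum_congr rfl fun c hc => by simp only [h' c hc]
      have hG : slack (n + 1) (fun c => (f c).1) (fun c => (f c).2.1) (children n p v) =
          slack (n + 1) (fun c => (g c).1) (fun c => (g c).2.1) (children n p v) :=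
        sup_congr rfl fun c hc => by simp only [h' c hc]
      have hT : ∀ j, topSum (children n p v)
            (gain (n + 1) (fun c => (f c).1) (fun c => (f c).2.1)) j =
          topSum (children n p v)
            (gain (n + 1) (fun c => (g c).1) (fun c => (g c).2.1)) j := fun j => by
        unfold topSum
        rw [sup_congr rfl hgain]
        refine sum_congr rfl fun i _ => ?_
        rw [filter_congr fun c hc => by rw [hgain c hc]]
      simp only [costOut, costDom, hin, hI, hS, hG, hT])
  exact ⟨fun c => (f c).1, fun c => (f c).2.1, fun c => (f c).2.2,
    fun v hv => congrArg (·.1) (hf v hv), fun v hv => congrArg (·.2.1) (hf v hv),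
    fun v hv => congrArg (·.2.2) (hf v hv)⟩

namespace IsCostTable

variable {n k : ℕ} {p A B D : ℕ → ℕ}

/-- Finite costs are at most the size of the subtree, and leaving a vertex out has finite cost
unless it is a leaf or has more than `k` forced children. -/
theorem le_size (h : IsCostTable n k p A B D) (hk : 1 ≤ k) {size : ℕ → ℕ}
    (hsize : ∀ v < n, size v = 1 + ∑ c ∈ children n p v, size c) (hle : ∀ v < n, size v ≤ n) :
    ∀ v < n, A v ≤ size v ∧ (B v < n + 1 → B v ≤ size v) ∧
      (numForced (n + 1) B (children n p v) ≤ k → (children n p v).Nonempty → B v < n + 1) := by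
  refine downward_induction (p := p) fun v hv ih => ?_
  have hsz := hsize v hv
  have hA : ∀ c ∈ children n p v, A c < n + 1 := fun c hc => by
    have := (ih c hc).1
    have := hle c (mem_children.1 hc).2.1
    omega
  have key : numForced (n + 1) B (children n p v) ≤ k → (children n p v).Nonempty →
      B v ≤ size v := by
    intro hI hne
    obtain ⟨P, hP, hfin, -, -, hsum⟩ := exists_subset_costOut (b := B) hk hA hne hI
    rw [h.eq_out v hv, ← hsum, hsz]
    refine le_trans (sum_le_sum fun c hc => ?_) (Nat.le_add_left _ _)
    split_ifs with hcP
    · exact (ih c hc).1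
    · exact (ih c hc).2.1 (hfin c hc hcP)
  refine ⟨?_, fun hB => ?_, fun hI hne => ?_⟩
  · rw [h.eq_in v hv, costIn, hsz]
    exact Nat.add_le_add_left (sum_le_sum fun c hc => (min_le_left _ _).trans (ih c hc).1) _
  · rw [h.eq_out v hv, costOut] at hB
    split_ifs at hB with hI
    · omega
    · rcases (children n p v).eq_empty_or_nonempty with he | hne
      · rw [he] at hB
        simp only [slack, sup_empty, bot_eq_zero, Nat.sub_zero] at hB
        omega
      · exact key (by omega) hne
  · have := key hI hne
    have := hle v hv
    omega

theorem bounds (h : IsCostTable n k p A B D) (hk : 1 ≤ k)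
    (hp : ∀ j, 0 < j → j < n → p j < j) : ∀ v < n, A v ≤ n ∧
      (numForced (n + 1) B (children n p v) ≤ k → (children n p v).Nonempty → B v ≤ n) := by
  obtain ⟨size, hsize⟩ := exists_subtree_sum n p fun _ => 1
  have hle : ∀ v < n, size v ≤ n := fun v hv => by
    simpa using subtree_sum_le hp hsize v hv
  intro v hv
  obtain ⟨h1, -, h3⟩ := h.le_size hk hsize hle v hv
  exact ⟨h1.trans (hle v hv), fun hI hne => Nat.lt_succ_iff.1 (h3 hI hne)⟩

theorem baseCost_le (h : IsCostTable n k p A B D) (hk : 1 ≤ k)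
    (hp : ∀ j, 0 < j → j < n → p j < j) {v : ℕ} (hv : v < n) :
    baseCost (n + 1) A B (children n p v) ≤ n ∧ ∑ c ∈ children n p v, min (A c) (D c) ≤ n := by
  obtain ⟨size, hsize⟩ := exists_subtree_sum n p fun _ => 1
  have hle : ∀ v < n, size v ≤ n := fun v hv => by
    simpa using subtree_sum_le hp hsize v hv
  have h1 := hsize v hv
  have h2 := hle v hv
  have h3 : ∀ c ∈ children n p v, A c ≤ size c ∧ (B c < n + 1 → B c ≤ size c) := fun c hc =>
    have := h.le_size hk hsize hle c (mem_children.1 hc).2.1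
    ⟨this.1, this.2.1⟩
  have h4 : baseCost (n + 1) A B (children n p v) ≤ ∑ c ∈ children n p v, size c := by
    refine sum_le_sum fun c hc => ?_
    split_ifs with hB
    · exact (h3 c hc).2 hB
    · exact (h3 c hc).1
  have h5 : ∑ c ∈ children n p v, min (A c) (D c) ≤ ∑ c ∈ children n p v, size c :=
    sum_le_sum fun c hc => (min_le_left _ _).trans (h3 c hc).1
  omega

theorem out_le (h : IsCostTable n k p A B D) (hk : 1 ≤ k)
    (hp : ∀ j, 0 < j → j < n → p j < j) {v : ℕ} (hv : v < n) : B v ≤ n + 1 := by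
  rcases (children n p v).eq_empty_or_nonempty with he | hne
  · rw [h.eq_out v hv, he]
    simp [costOut, slack, baseCost, numForced]
  · by_cases hI : numForced (n + 1) B (children n p v) ≤ k
    · have := (h.bounds hk hp v hv).2 hI hne
      omega
    · rw [h.eq_out v hv, costOut, if_pos (by omega)]

theorem dom_le (h : IsCostTable n k p A B D) (hk : 1 ≤ k)
    (hp : ∀ j, 0 < j → j < n → p j < j) {v : ℕ} (hv : v < n) : D v ≤ n + 1 := by
  have := (h.baseCost_le hk hp hv).1
  rw [h.eq_dom v hv, costDom]
  split_ifs <;> omega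

/-- A vertex that is forced is a leaf or has infinite cost `D`. -/
theorem in_le_dom (h : IsCostTable n k p A B D) (hk : 1 ≤ k)
    (hp : ∀ j, 0 < j → j < n → p j < j) {v : ℕ} (hv : v < n) (hB : n + 1 ≤ B v) :
    A v ≤ D v + 1 := by
  rcases (children n p v).eq_empty_or_nonempty with he | hne
  · rw [h.eq_in v hv, he]
    simp [costIn]
  · obtain ⟨h1, h2⟩ := h.bounds hk hp v hv
    rw [h.eq_dom v hv, costDom, if_neg]
    · omega
    · intro hlt
      have := h2 hlt.le hne
      omega

/-- The bucket ranges add up to at most `2 * n`. -/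
theorem sum_bucketRange_le (h : IsCostTable n k p A B D) (hk : 1 ≤ k)
    (hp : ∀ j, 0 < j → j < n → p j < j) :
    ∑ v ∈ range n, bucketRange (n + 1) k A B (children n p v) ≤ 2 * n := by
  have h1 : ∀ v ∈ range n, spread (n + 1) (A v) (B v) (D v) +
      bucketRange (n + 1) k A B (children n p v) ≤
      1 + ∑ c ∈ children n p v, (1 + spread (n + 1) (A c) (B c) (D c)) := fun v hv => by
    rw [mem_range] at hv
    rw [h.eq_in v hv, h.eq_out v hv, h.eq_dom v hv]
    refine spread_add_bucketRange_le hk (fun c hc => ?_) fun c hc hB => ?_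
    · exact Nat.lt_succ_of_le (h.bounds hk hp c (mem_children.1 hc).2.1).1
    · exact h.in_le_dom hk hp (mem_children.1 hc).2.1 hB
  have h2 := sum_le_sum h1
  rw [sum_add_distrib, sum_add_distrib, sum_sum_children hp, sum_add_distrib] at h2
  have h3 : ∑ c ∈ Ico 1 n, spread (n + 1) (A c) (B c) (D c) ≤
      ∑ c ∈ range n, spread (n + 1) (A c) (B c) (D c) :=
    sum_le_sum_of_subset fun c hc => mem_range.2 (mem_Ico.1 hc).2
  simp only [sum_const, Nat.card_Ico, card_range, smul_eq_mul, mul_one] at h2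
  omega

end IsCostTable

/-! ### Quasiperfect domination in terms of a parent array -/

/-- The number of neighbours of the vertex number `v` whose numbers are in `X`. -/
def numDominators (n : ℕ) (p : ℕ → ℕ) (X : Finset ℕ) (v : ℕ) : ℕ :=
  #{c ∈ children n p v | c ∈ X} + if 0 < v ∧ p v ∈ X then 1 else 0

section ParentArray

variable {V : Type*} {T : SimpleGraph V} {n : ℕ} {num : Fin n ≃ V} {p : ℕ → ℕ}

theorem ncard_neighborSet_inter (h : IsParentArray T num p) (X : Finset ℕ) (v : Fin n) :
    (T.neighborSet (num v) ∩ {u | (num.symm u).1 ∈ X}).ncard =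
      numDominators n p X v := by
  have hinj : Function.Injective fun u => (num.symm u).1 :=
    Fin.val_injective.comp num.symm.injective
  have himage : (fun u => (num.symm u).1) '' (T.neighborSet (num v) ∩ {u | (num.symm u).1 ∈ X}) =
      ((({c ∈ children n p v | c ∈ X} ∪ if 0 < v.1 ∧ p v ∈ X then {p v} else ∅) :
        Finset ℕ) : Set ℕ) := by
    ext j
    simp only [Set.mem_image, Set.mem_inter_iff, SimpleGraph.mem_neighborSet, Set.mem_ofPred_eq,
      coe_union, Set.mem_union, mem_coe, mem_filter, mem_children]
    constructor
    · rintro ⟨u, ⟨hadj, hu⟩, rfl⟩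
      obtain ⟨i, rfl⟩ := num.surjective u
      rw [Equiv.symm_apply_apply] at hu ⊢
      rcases lt_trichotomy v i with hlt | rfl | hlt
      · exact Or.inl ⟨⟨hlt, i.2, (h.2 v i hlt).1 hadj⟩, hu⟩
      · exact absurd hadj (T.loopless.irrefl _)
      · have := (h.2 i v hlt).1 hadj.symm
        right
        rw [if_pos ⟨lt_of_le_of_lt (Nat.zero_le _) hlt, this ▸ hu⟩, this]
        exact mem_singleton_self _
    · rintro (⟨⟨h1, h2, h3⟩, h4⟩ | hj)
      · exact ⟨num ⟨j, h2⟩, ⟨(h.2 v ⟨j, h2⟩ h1).2 h3, by simpa using h4⟩, by simp⟩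
      · split_ifs at hj with hv
        · rw [mem_singleton] at hj
          subst hj
          have hlt := h.1 v hv.1 v.2
          exact ⟨num ⟨p v, hlt.trans v.2⟩,
            ⟨((h.2 ⟨p v, hlt.trans v.2⟩ v hlt).2 rfl).symm, by simpa using hv.2⟩, by simp⟩
        · simp at hj
  rw [← Set.ncard_image_of_injective _ hinj, himage, Set.ncard_coe_finset, card_union_of_disjoint,
    numDominators]
  · split_ifs <;> simp
  · rw [disjoint_left]
    intro c hc hc'
    rw [mem_filter, mem_children] at hc
    split_ifs at hc' with hv
    · rw [mem_singleton] at hc'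
      have := h.1 v hv.1 v.2
      omega
    · simp at hc'

theorem isQuasiperfectDominating_iff (h : IsParentArray T num p)
    (X : Finset ℕ) (k : ℕ) :
    IsQuasiperfectDominating T k {u | (num.symm u).1 ∈ X} ↔
      ∀ v < n, v ∉ X → 1 ≤ numDominators n p X v ∧ numDominators n p X v ≤ k := by
  have hfin : Finite V := Finite.of_equiv _ num
  have key : ∀ v : Fin n, ((∃ u ∈ {u | (num.symm u).1 ∈ X}, T.Adj (num v) u) ∧
      (T.neighborSet (num v) ∩ {u | (num.symm u).1 ∈ X}).ncard ≤ k) ↔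
      1 ≤ numDominators n p X v ∧ numDominators n p X v ≤ k := by
    intro v
    rw [← ncard_neighborSet_inter h X v, Nat.one_le_iff_ne_zero, Ne,
      Set.ncard_eq_zero (Set.toFinite _), ← Ne, ← Set.nonempty_iff_ne_empty]
    refine and_congr_left' ⟨?_, ?_⟩
    · rintro ⟨u, hu, hadj⟩
      exact ⟨u, hadj, hu⟩
    · rintro ⟨u, hadj, hu⟩
      exact ⟨u, hu, hadj⟩
  constructor
  · intro hS v hv hvX
    exact (key ⟨v, hv⟩).1 (hS (num ⟨v, hv⟩) (by simpa using hvX))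
  · intro hX' u hu
    obtain ⟨v, rfl⟩ := num.surjective u
    exact (key v).2 (hX' v v.2 (by simpa using hu))

theorem ncard_setOf_mem {X : Finset ℕ} (hX : X ⊆ range n) :
    {u : V | (num.symm u).1 ∈ X}.ncard = #X := by
  have hinj : Function.Injective fun u => (num.symm u).1 :=
    Fin.val_injective.comp num.symm.injective
  rw [← Set.ncard_image_of_injective _ hinj, ← Set.ncard_coe_finset]
  congr 1
  ext j
  constructor
  · rintro ⟨u, hu, rfl⟩
    exact hu
  · intro hj
    exact ⟨num ⟨j, mem_range.1 (hX hj)⟩, by simpa using hj, by simp⟩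

theorem exists_eq_setOf_mem (num : Fin n ≃ V) (S : Set V) :
    ∃ X ⊆ range n, S = {u | (num.symm u).1 ∈ X} := by
  classical
  refine ⟨{j ∈ range n | ∃ u ∈ S, (num.symm u).1 = j}, filter_subset _ _, ?_⟩
  ext u
  simp only [mem_filter, mem_range, Fin.is_lt, true_and, Set.mem_ofPred_eq]
  constructor
  · intro hu
    exact ⟨u, hu, rfl⟩
  · rintro ⟨w, hw, heq⟩
    rwa [← num.symm.injective (Fin.val_injective heq)]

end ParentArray

/-! ### Correctness of the dynamic programme -/

namespace IsCostTable

variable {n k : ℕ} {p A B D : ℕ → ℕ}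

/-- The part of a dominating set in the subtree of a vertex is at least as large as the cost for
the situation of the vertex. -/
theorem min_le_card (h : IsCostTable n k p A B D) (hk : 1 ≤ k) (hn : 0 < n)
    (hp : ∀ j, 0 < j → j < n → p j < j) {X : Finset ℕ} (hX : X ⊆ range n)
    (hdom : ∀ v < n, v ∉ X → 1 ≤ numDominators n p X v ∧ numDominators n p X v ≤ k) :
    min (A 0) (B 0) ≤ #X := by
  obtain ⟨f, hf⟩ := exists_subtree_sum n p fun v => if v ∈ X then 1 else 0
  have hsum : ∑ v ∈ range n, (if v ∈ X then 1 else 0) = #X := by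
    rw [sum_ite_mem, inter_eq_right.2 hX, card_eq_sum_ones]
  have hXn : #X ≤ n := by simpa using card_le_card hX
  have hle : ∀ v < n, f v ≤ n := fun v hv =>
    (subtree_sum_le hp hf v hv).trans (hsum.trans_le hXn)
  have main : ∀ v < n, (v ∈ X → A v ≤ f v) ∧
      (v ∉ X → ¬ (0 < v ∧ p v ∈ X) → B v ≤ f v) ∧
      (v ∉ X → (0 < v ∧ p v ∈ X) → D v ≤ f v) := by
    refine downward_induction (p := p) fun v hv ih => ?_
    have hch : ∀ c ∈ children n p v, 0 < c ∧ p c = v := fun c hc => by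
      rw [mem_children] at hc
      exact ⟨by omega, hc.2.2⟩
    have hA : ∀ c ∈ children n p v, A c < n + 1 := fun c hc =>
      Nat.lt_succ_of_le (h.bounds hk hp c (mem_children.1 hc).2.1).1
    refine ⟨fun hvX => ?_, fun hvX hpar => ?_, fun hvX hpar => ?_⟩
    · rw [h.eq_in v hv, hf v hv, if_pos hvX, costIn]
      refine Nat.add_le_add_left (sum_le_sum fun c hc => ?_) _
      obtain ⟨h1, -, h3⟩ := ih c hc
      by_cases hcX : c ∈ X
      · exact (min_le_left _ _).trans (h1 hcX)
      · exact (min_le_right _ _).trans (h3 hcX ⟨(hch c hc).1, by rwa [(hch c hc).2]⟩)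
    all_goals
      have hB : ∀ c ∈ children n p v, c ∉ {c ∈ children n p v | c ∈ X} → B c ≤ f c := by
        intro c hc hcX
        simp only [mem_filter, hc, true_and] at hcX
        refine (ih c hc).2.1 hcX ?_
        rw [(hch c hc).2]
        exact fun h => hvX h.2
      have hfin : ∀ c ∈ children n p v, c ∉ {c ∈ children n p v | c ∈ X} → B c < n + 1 :=
        fun c hc hcX => Nat.lt_succ_of_le
          ((hB c hc hcX).trans (hle c (mem_children.1 hc).2.1))
      have hcost : ∑ c ∈ children n p v,
          (if c ∈ {c ∈ children n p v | c ∈ X} then A c else B c) ≤ f v := by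
        rw [hf v hv, if_neg hvX, zero_add]
        refine sum_le_sum fun c hc => ?_
        split_ifs with hcX
        · exact (ih c hc).1 (mem_filter.1 hcX).2
        · exact hB c hc hcX
      have hd := hdom v hv hvX
      rw [numDominators] at hd
    · rw [if_neg hpar] at hd
      rw [h.eq_out v hv]
      exact (costOut_le hA (filter_subset _ _) hfin (card_pos.1 (by omega)) (by omega)).trans hcost
    · rw [if_pos hpar] at hd
      rw [h.eq_dom v hv]
      exact (costDom_le (filter_subset _ _) hfin (by omega)).trans hcost
  obtain ⟨h1, h2, -⟩ := main 0 hn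
  rw [← hsum, ← subtree_sum_root hn hp hf]
  by_cases h0 : 0 ∈ X
  · exact (min_le_left _ _).trans (h1 h0)
  · exact (min_le_right _ _).trans (h2 h0 (by simp))

end IsCostTable

/-- The situation of a vertex with respect to a dominating set: in it, outside it together with its
parent, or outside it with its parent inside. -/
inductive Status : Type where
  | chosen
  | out
  | dominated
  deriving DecidableEq

namespace IsCostTable

variable {n k : ℕ} {p A B D : ℕ → ℕ}

/-- A dominating set of the computed size, found by assigning a status to the vertices from the
root downwards. -/
theorem exists_card_eq (h : IsCostTable n k p A B D) (hk : 1 ≤ k) (hn : 0 < n)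
    (hp : ∀ j, 0 < j → j < n → p j < j) :
    ∃ X ⊆ range n, (∀ v < n, v ∉ X →
      1 ≤ numDominators n p X v ∧ numDominators n p X v ≤ k) ∧ #X = min (A 0) (B 0) := by
  have hA : ∀ v < n, A v < n + 1 := fun v hv => Nat.lt_succ_of_le (h.bounds hk hp v hv).1
  have hAc : ∀ v, ∀ c ∈ children n p v, A c < n + 1 := fun v c hc =>
    hA c (mem_children.1 hc).2.1
  -- The children to choose below a vertex outside the set, by the status of the vertex.
  have hout : ∀ v, ∃ P, v < n → B v < n + 1 → P ⊆ children n p v ∧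
      (∀ c ∈ children n p v, c ∉ P → B c < n + 1) ∧ (1 ≤ #P ∧ #P ≤ k) ∧
      ∑ c ∈ children n p v, (if c ∈ P then A c else B c) = B v := by
    intro v
    by_cases hv : v < n ∧ B v < n + 1
    · obtain ⟨hv, hB⟩ := hv
      have hB' := hB
      rw [h.eq_out v hv, costOut] at hB'
      split_ifs at hB' with hI
      · omega
      · rcases (children n p v).eq_empty_or_nonempty with he | hne
        · rw [he] at hB'
          simp only [slack, sup_empty, bot_eq_zero, Nat.sub_zero] at hB'
          omega
        · obtain ⟨P, h1, h2, h3, h4, h5⟩ :=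
            exists_subset_costOut (b := B) hk (hAc v) hne (not_lt.1 hI)
          rw [← h.eq_out v hv] at h5
          exact ⟨P, fun _ _ => ⟨h1, h2, ⟨card_pos.2 h3, h4⟩, h5⟩⟩
    · exact ⟨∅, fun h1 h2 => absurd ⟨h1, h2⟩ hv⟩
  have hdom : ∀ v, ∃ P, v < n → D v < n + 1 → P ⊆ children n p v ∧
      (∀ c ∈ children n p v, c ∉ P → B c < n + 1) ∧ #P < k ∧
      ∑ c ∈ children n p v, (if c ∈ P then A c else B c) = D v := by
    intro v
    by_cases hv : v < n ∧ D v < n + 1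
    · obtain ⟨hv, hD⟩ := hv
      rw [h.eq_dom v hv] at hD
      obtain ⟨P, hP⟩ := exists_subset_costDom hD
      rw [← h.eq_dom v hv] at hP
      exact ⟨P, fun _ _ => hP⟩
    · exact ⟨∅, fun h1 h2 => absurd ⟨h1, h2⟩ hv⟩
  choose PB hPB using hout
  choose PD hPD using hdom
  obtain ⟨σ, hσ0, hσ⟩ := exists_upward_rec n p hp (if A 0 ≤ B 0 then Status.chosen else .out)
    fun v s => match s with
      | .chosen => if A v ≤ D v then .chosen else .dominated
      | .out => if v ∈ PB (p v) then .chosen else .out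
      | .dominated => if v ∈ PD (p v) then .chosen else .out
  have hch : ∀ v, ∀ c ∈ children n p v, 0 < c ∧ c < n ∧ p c = v := fun v c hc => by
    rw [mem_children] at hc
    exact ⟨by omega, hc.2⟩
  -- The status of the children in terms of the status of their parent.
  have hσc : ∀ v, ∀ c ∈ children n p v,
      (σ v = .chosen → σ c = if A c ≤ D c then .chosen else .dominated) ∧
      (σ v = .out → σ c = if c ∈ PB v then .chosen else .out) ∧
      (σ v = .dominated → σ c = if c ∈ PD v then .chosen else .out) := by
    intro v c hc
    obtain ⟨h1, h2, h3⟩ := hch v c hc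
    have := hσ c h1 h2
    rw [h3] at this
    refine ⟨fun hs => ?_, fun hs => ?_, fun hs => ?_⟩ <;> rw [this, hs]
  have hgood : ∀ v < n, (σ v = .out → B v < n + 1) ∧ (σ v = .dominated → D v < n + 1) := by
    intro v
    induction v using Nat.strong_induction_on with
    | _ v ih =>
      intro hv
      rcases Nat.eq_zero_or_pos v with rfl | h0
      · rw [hσ0]
        have := hA 0 hn
        split_ifs
        · simp
        · simp
          omega
      · have hlt := hp v h0 hv
        have hvc : v ∈ children n p (p v) := mem_children.2 ⟨hlt, hv, rfl⟩
        obtain ⟨h1, h2, h3⟩ := hσc (p v) v hvc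
        obtain ⟨i1, i2⟩ := ih (p v) hlt (hlt.trans hv)
        have := hA v hv
        cases hs : σ (p v) with
        | chosen =>
          rw [h1 hs]
          split_ifs
          · simp
          · simp
            omega
        | out =>
          rw [h2 hs]
          split_ifs with hm
          · simp
          · simpa using (hPB (p v) (hlt.trans hv) (i1 hs)).2.1 v hvc hm
        | dominated =>
          rw [h3 hs]
          split_ifs with hm
          · simp
          · simpa using (hPD (p v) (hlt.trans hv) (i2 hs)).2.1 v hvc hm
  have hX : ∀ v < n, (v ∈ {v ∈ range n | σ v = .chosen} ↔ σ v = .chosen) := fun v hv => by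
    simp [hv]
  refine ⟨{v ∈ range n | σ v = .chosen}, filter_subset _ _, fun v hv hvX => ?_, ?_⟩
  · rw [hX v hv] at hvX
    have hcount : ∀ P ⊆ children n p v,
        (∀ c ∈ children n p v, σ c = if c ∈ P then .chosen else .out) →
        #{c ∈ children n p v | c ∈ {v ∈ range n | σ v = .chosen}} = #P := by
      intro P hP hc
      congr 1
      ext c
      rw [mem_filter]
      constructor
      · rintro ⟨h1, h2⟩
        rw [hX c (hch v c h1).2.1, hc c h1] at h2
        by_contra h3
        simp [h3] at h2
      · intro h1
        refine ⟨hP h1, ?_⟩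
        rw [hX c (hch v c (hP h1)).2.1, hc c (hP h1), if_pos h1]
    have hparent : (0 < v ∧ p v ∈ {v ∈ range n | σ v = .chosen}) ↔ σ v = .dominated := by
      rcases Nat.eq_zero_or_pos v with rfl | h0
      · rw [hσ0]
        split_ifs <;> simp
      · have hlt := hp v h0 hv
        obtain ⟨h1, h2, h3⟩ := hσc (p v) v (mem_children.2 ⟨hlt, hv, rfl⟩)
        rw [hX _ (hlt.trans hv)]
        cases hs : σ (p v) with
        | chosen =>
          rw [h1 hs] at hvX ⊢
          split_ifs at hvX ⊢ <;> simp_all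
        | out =>
          rw [h2 hs]
          split_ifs <;> simp
        | dominated =>
          rw [h3 hs]
          split_ifs <;> simp
    rw [numDominators]
    cases hs : σ v with
    | chosen => exact absurd hs hvX
    | out =>
      obtain ⟨h1, -, h3, -⟩ := hPB v hv ((hgood v hv).1 hs)
      rw [if_neg (by rw [hparent, hs]; simp),
        hcount (PB v) h1 fun c hc => (hσc v c hc).2.1 hs]
      exact h3
    | dominated =>
      obtain ⟨h1, -, h3, -⟩ := hPD v hv ((hgood v hv).2 hs)
      rw [if_pos (hparent.2 hs), hcount (PD v) h1 fun c hc => (hσc v c hc).2.2 hs]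
      omega
  · obtain ⟨f, hf⟩ := exists_subtree_sum n p fun v => if σ v = .chosen then 1 else 0
    have hval : ∀ v < n, f v = match σ v with
        | .chosen => A v
        | .out => B v
        | .dominated => D v := by
      refine downward_induction (p := p) fun v hv ih => ?_
      rw [hf v hv]
      have hsub : ∀ P : Finset ℕ,
          (∀ c ∈ children n p v, σ c = if c ∈ P then .chosen else .out) →
          ∑ c ∈ children n p v, f c =
            ∑ c ∈ children n p v, if c ∈ P then A c else B c := by
        intro P hc
        refine sum_congr rfl fun c hcv => ?_
        rw [ih c hcv, hc c hcv]
        split_ifs <;> rfl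
      cases hs : σ v with
      | chosen =>
        rw [h.eq_in v hv, costIn, if_pos rfl]
        refine congrArg _ (sum_congr rfl fun c hcv => ?_)
        rw [ih c hcv, (hσc v c hcv).1 hs]
        split_ifs with hle
        · exact (min_eq_left hle).symm
        · exact (min_eq_right (not_le.1 hle).le).symm
      | out =>
        rw [hsub (PB v) fun c hc => (hσc v c hc).2.1 hs,
          (hPB v hv ((hgood v hv).1 hs)).2.2.2]
        simp
      | dominated =>
        rw [hsub (PD v) fun c hc => (hσc v c hc).2.2 hs,
          (hPD v hv ((hgood v hv).2 hs)).2.2.2]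
        simp
    rw [card_filter, ← subtree_sum_root hn hp hf, hval 0 hn, hσ0]
    split_ifs with hle
    · exact (min_eq_left hle).symm
    · exact (min_eq_right (not_le.1 hle).le).symm

end IsCostTable

theorem quasiperfectDominationNumber_eq {V : Type*} [Finite V] {T : SimpleGraph V} {n k : ℕ}
    {num : Fin n ≃ V} {p A B D : ℕ → ℕ} (hpar : IsParentArray T num p) (hn : 0 < n)
    (hk : 1 ≤ k) (h : IsCostTable n k p A B D) :
    quasiperfectDominationNumber T k = min (A 0) (B 0) := by
  refine (isLeast_quasiperfectDominationNumber T k).unique ⟨?_, ?_⟩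
  · obtain ⟨X, hX, hdom, hcard⟩ := h.exists_card_eq hk hn hpar.1
    exact ⟨_, (isQuasiperfectDominating_iff hpar X k).2 hdom,
      (ncard_setOf_mem hX).trans hcard⟩
  · rintro m ⟨S, hS, rfl⟩
    obtain ⟨X, hX, rfl⟩ := exists_eq_setOf_mem num S
    rw [ncard_setOf_mem hX]
    exact h.min_le_card hk hn hpar.1 hX ((isQuasiperfectDominating_iff hpar X k).1 hS)

/-! ### Running programs with a time bound -/

namespace RAM

@[simp]
theorem State.setVar_var (s : State) (x m y : ℕ) :
    (s.setVar x m).var y = if y = x then m else s.var y := by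
  simp [State.setVar, Function.update_apply]

@[simp]
theorem State.setVar_arr (s : State) (x m : ℕ) : (s.setVar x m).arr = s.arr := rfl

@[simp]
theorem State.setArr_var (s : State) (a i m : ℕ) : (s.setArr a i m).var = s.var := rfl

@[simp]
theorem State.setArr_arr (s : State) (a i m b : ℕ) :
    (s.setArr a i m).arr b = if b = a then Function.update (s.arr a) i m else s.arr b := by
  simp [State.setArr, Function.update_apply]

/-- The final state of a program without loops. -/
def Prog.post : Prog → State → State
  | .skip, s => s
  | .assign x e, s => s.setVar x (e.eval s)
  | .store a i e, s => s.setArr a (i.eval s) (e.eval s)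
  | .seq P Q, s => Q.post (P.post s)
  | .ite e₁ e₂ P Q, s => if e₁.eval s < e₂.eval s then P.post s else Q.post s
  | .loop _ _ _, s => s

/-- The program has no loops and all numbers that occur are at most `w`. -/
def Prog.Ok (w : ℕ) : Prog → State → Prop
  | .skip, _ => True
  | .assign _ e, s => e.Fits w s
  | .store _ i e, s => i.Fits w s ∧ e.Fits w s
  | .seq P Q, s => P.Ok w s ∧ Q.Ok w (P.post s)
  | .ite e₁ e₂ P Q, s => e₁.Fits w s ∧ e₂.Fits w s ∧
      (e₁.eval s < e₂.eval s → P.Ok w s) ∧ (¬ e₁.eval s < e₂.eval s → Q.Ok w s)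
  | .loop _ _ _, _ => False

/-- An upper bound for the running time of a program without loops. -/
def Prog.maxCost : Prog → ℕ
  | .skip => 1
  | .assign _ e => e.cost + 1
  | .store _ i e => i.cost + e.cost + 1
  | .seq P Q => P.maxCost + Q.maxCost
  | .ite e₁ e₂ P Q => e₁.cost + e₂.cost + 1 + (P.maxCost + Q.maxCost)
  | .loop _ _ _ => 0

theorem exec_of_ok {w : ℕ} {P : Prog} {s : State} (h : P.Ok w s) :
    ∃ t ≤ P.maxCost, Exec w P s t (P.post s) := by
  induction P generalizing s with
  | skip => exact ⟨1, le_rfl, .skip s⟩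
  | assign x e => exact ⟨_, le_rfl, .assign x e s h⟩
  | store a i e => exact ⟨_, le_rfl, .store a i e s h.1 h.2⟩
  | seq P Q ihP ihQ =>
    obtain ⟨t₁, h₁, e₁⟩ := ihP h.1
    obtain ⟨t₂, h₂, e₂⟩ := ihQ h.2
    exact ⟨_, Nat.add_le_add h₁ h₂, .seq e₁ e₂⟩
  | ite e₁ e₂ P Q ihP ihQ =>
    obtain ⟨f₁, f₂, hP, hQ⟩ := h
    by_cases hlt : e₁.eval s < e₂.eval s
    · obtain ⟨t, ht, e⟩ := ihP (hP hlt)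
      refine ⟨_, ?_, by simpa [Prog.post, hlt] using Exec.ite_true (Q := Q) f₁ f₂ hlt e⟩
      rw [Prog.maxCost]
      omega
    · obtain ⟨t, ht, e⟩ := ihQ (hQ hlt)
      refine ⟨_, ?_, by simpa [Prog.post, hlt] using Exec.ite_false (P := P) f₁ f₂ hlt e⟩
      rw [Prog.maxCost]
      omega
  | loop e₁ e₂ P => exact h.elim

/-- With word bound `w`, the program `P` started in `s` halts within `c` steps in a state
satisfying `Q`. -/
def Runs (w : ℕ) (P : Prog) (s : State) (c : ℕ) (Q : State → Prop) : Prop :=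
  ∃ t s', Exec w P s t s' ∧ t ≤ c ∧ Q s'

theorem Runs.of_ok {w c : ℕ} {P : Prog} {s : State} {Q : State → Prop} (h : P.Ok w s)
    (hc : P.maxCost ≤ c) (hQ : Q (P.post s)) : Runs w P s c Q :=
  let ⟨t, ht, e⟩ := exec_of_ok h
  ⟨t, _, e, ht.trans hc, hQ⟩

theorem Runs.mono {w c c' : ℕ} {P : Prog} {s : State} {Q Q' : State → Prop}
    (h : Runs w P s c Q) (hc : c ≤ c') (hQ : ∀ s, Q s → Q' s) : Runs w P s c' Q' :=
  let ⟨t, s', e, ht, hs⟩ := h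
  ⟨t, s', e, ht.trans hc, hQ s' hs⟩

theorem Runs.seq {w c₁ c₂ : ℕ} {P R : Prog} {s : State} {Q' Q : State → Prop}
    (h : Runs w P s c₁ Q') (h' : ∀ s, Q' s → Runs w R s c₂ Q) :
    Runs w (.seq P R) s (c₁ + c₂) Q := by
  obtain ⟨t₁, s₁, e₁, ht₁, h₁⟩ := h
  obtain ⟨t₂, s₂, e₂, ht₂, h₂⟩ := h' s₁ h₁
  exact ⟨_, s₂, .seq e₁ e₂, Nat.add_le_add ht₁ ht₂, h₂⟩

theorem Runs.ite {w c : ℕ} {e₁ e₂ : Expr} {P R : Prog} {s : State} {Q : State → Prop}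
    (h₁ : e₁.Fits w s) (h₂ : e₂.Fits w s) (hP : e₁.eval s < e₂.eval s → Runs w P s c Q)
    (hR : ¬ e₁.eval s < e₂.eval s → Runs w R s c Q) :
    Runs w (.ite e₁ e₂ P R) s (e₁.cost + e₂.cost + 1 + c) Q := by
  by_cases h : e₁.eval s < e₂.eval s
  · obtain ⟨t, s', e, ht, hs⟩ := hP h
    exact ⟨_, s', .ite_true h₁ h₂ h e, Nat.add_le_add_left ht _, hs⟩
  · obtain ⟨t, s', e, ht, hs⟩ := hR h
    exact ⟨_, s', .ite_false h₁ h₂ h e, Nat.add_le_add_left ht _, hs⟩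

/-- A loop with an invariant indexed by the number of remaining rounds. -/
theorem Runs.loop {w : ℕ} {e₁ e₂ : Expr} {P : Prog} {Inv : ℕ → State → Prop} {c : ℕ → ℕ}
    (h0 : ∀ s, Inv 0 s → e₁.Fits w s ∧ e₂.Fits w s ∧ ¬ e₁.eval s < e₂.eval s)
    (hs : ∀ m s, Inv (m + 1) s → e₁.Fits w s ∧ e₂.Fits w s ∧ e₁.eval s < e₂.eval s ∧
      Runs w P s (c m) (Inv m)) (m : ℕ) (s : State) (h : Inv m s) :
    Runs w (.loop e₁ e₂ P) s ((m + 1) * (e₁.cost + e₂.cost + 1) + ∑ i ∈ range m, c i)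
      (Inv 0) := by
  induction m generalizing s with
  | zero =>
    obtain ⟨f₁, f₂, hlt⟩ := h0 s h
    exact ⟨_, s, .loop_false f₁ f₂ hlt, by simp, h⟩
  | succ m ih =>
    obtain ⟨f₁, f₂, hlt, t₁, s₁, e, ht₁, hinv⟩ := hs m s h
    obtain ⟨t₂, s₂, e', ht₂, hinv'⟩ := ih s₁ hinv
    refine ⟨_, s₂, .loop_true f₁ f₂ hlt e e', ?_, hinv'⟩
    rw [sum_range_succ, Nat.succ_mul (m + 1)]
    omega

/-! ### Linked lists and buckets -/

/-- Starting at `x` and following `next`, one meets the entries of the list and then `0`, which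
marks the end. -/
def IsLinked (next : ℕ → ℕ) : ℕ → List ℕ → Prop
  | x, [] => x = 0
  | x, c :: l => x = c ∧ 0 < c ∧ IsLinked next (next c) l

theorem IsLinked.congr {f g : ℕ → ℕ} {l : List ℕ} {x : ℕ} (h : IsLinked f x l)
    (hfg : ∀ c ∈ l, f c = g c) : IsLinked g x l := by
  induction l generalizing x with
  | nil => exact h
  | cons c l ih =>
    obtain ⟨h1, h2, h3⟩ := h
    rw [hfg c List.mem_cons_self] at h3
    exact ⟨h1, h2, ih h3 fun d hd => hfg d (List.mem_cons_of_mem _ hd)⟩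

theorem IsLinked.le {f : ℕ → ℕ} {l : List ℕ} {x w : ℕ} (h : IsLinked f x l)
    (hl : ∀ c ∈ l, c ≤ w) : x ≤ w := by
  cases l with
  | nil => exact (show x = 0 from h) ▸ Nat.zero_le w
  | cons c l => exact h.1 ▸ hl c List.mem_cons_self

/-- One round of `fillBuckets`: count the value of the current list entry, update the maximum, and
move on to the next entry. -/
def bucketStep : Prog :=
  .seq (.store 8 (.get 7 (.var 4)) (.add (.get 8 (.get 7 (.var 4))) (.lit 1)))
    (.seq (.assign 5 (.add (.var 5) (.sub (.get 7 (.var 4)) (.var 5))))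
      (.assign 4 (.get 6 (.var 4))))

/-- Sort the linked list that starts at variable `4`, with links in array `6` and values in array
`7`, into the buckets of array `8`; variable `5` becomes the largest value. -/
def fillBuckets : Prog := .loop (.lit 0) (.var 4) bucketStep

/-- One round of `sumLevels`: empty the bucket of the current level into the running count and add
the contribution of the level. The minimum of `x` and `y` is `x - (x - y)`. -/
def levelStep : Prog :=
  .seq (.assign 6 (.add (.var 6) (.get 8 (.var 5))))
    (.seq (.store 8 (.var 5) (.lit 0))
      (.seq (.assign 7 (.add (.var 7) (.sub (.var 6) (.sub (.var 6) (.var 9)))))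
        (.seq (.assign 8 (.add (.var 8)
            (.sub (.var 6) (.sub (.var 6) (.sub (.var 9) (.lit 1))))))
          (.assign 5 (.sub (.var 5) (.lit 1))))))

/-- Sum the levels from variable `5` down to `1`: variables `7` and `8` become the largest sums of
at most `j` values for `j` the value of variable `9` and for `j` one less. -/
def sumLevels : Prog := .loop (.lit 0) (.var 5) levelStep

theorem runs_fillBuckets {w : ℕ} {s : State} {g : ℕ → ℕ} {l : List ℕ}
    (hlink : IsLinked (s.arr 6) (s.var 4) l) (hg : ∀ c ∈ l, s.arr 7 c = g c)
    (h8 : ∀ i, s.arr 8 i = 0) (h5 : s.var 5 = 0) (hlen : l.length + 1 ≤ w)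
    (hl : ∀ c ∈ l, c ≤ w) (hgw : ∀ c ∈ l, g c ≤ w) :
    Runs w fillBuckets s (3 + 21 * l.length) fun s' =>
      (∀ i, s'.arr 8 i = l.countP (g · = i)) ∧ s'.var 5 = l.toFinset.sup g ∧
      (∀ a, a ≠ 8 → s'.arr a = s.arr a) ∧ ∀ x, x ≠ 4 → x ≠ 5 → s'.var x = s.var x := by
  refine (Runs.loop (c := fun _ => 18) (Inv := fun m s' => ∃ done rest, l = done ++ rest ∧
    rest.length = m ∧ IsLinked (s'.arr 6) (s'.var 4) rest ∧
    (∀ i, s'.arr 8 i = done.countP (g · = i)) ∧ s'.var 5 = done.toFinset.sup g ∧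
    (∀ a, a ≠ 8 → s'.arr a = s.arr a) ∧ ∀ x, x ≠ 4 → x ≠ 5 → s'.var x = s.var x)
    ?_ ?_ l.length s ?_).mono ?_ ?_
  · rintro s' ⟨done, rest, -, hr, hlk, -⟩
    rw [List.length_eq_zero_iff] at hr
    subst hr
    have h4 : s'.var 4 = 0 := hlk
    simp [Expr.Fits, Expr.eval, h4]
  · rintro m s' ⟨done, rest, hl', hr, hlk, h8', h5', harr, hvar⟩
    cases rest with
    | nil => simp at hr
    | cons c rest =>
      obtain ⟨h4, hc, hlk'⟩ := hlk
      have hcl : c ∈ l := by simp [hl']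
      have h7 : s'.arr 7 c = g c := by rw [harr 7 (by decide), hg c hcl]
      have hcw := hl c hcl
      have hgc := hgw c hcl
      have hcount : done.countP (g · = g c) + 1 ≤ w := by
        have h1 : done.countP (g · = g c) ≤ done.length := List.countP_le_length
        have h2 := congrArg List.length hl'
        simp at h2
        omega
      have hsup : s'.var 5 ≤ w := by
        rw [h5']
        refine Finset.sup_le fun d hd => hgw d ?_
        simp [hl', List.mem_toFinset.1 hd]
      have hnext : s'.arr 6 c ≤ w := hlk'.le fun d hd => hl d (by simp [hl', hd])
      refine ⟨by simp [Expr.Fits], by simp [Expr.Fits, h4, hcw], by simp [Expr.eval, h4, hc],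
        Runs.of_ok ?_ (by decide) ⟨done ++ [c], rest, by simp [hl'], by simpa using hr, ?_⟩⟩
      · simp [bucketStep, Prog.Ok, Prog.post, Expr.Fits, Expr.eval, h4, h7, h8']
        omega
      · refine ⟨?_, fun i => ?_, ?_, fun a ha => ?_, fun x h1 h2 => ?_⟩
        · simpa [bucketStep, Prog.post, Expr.eval, h4] using hlk'
        · simp only [bucketStep, Prog.post, Expr.eval, State.setVar_arr, State.setArr_arr, h4, h7,
            h8', if_true, Function.update_apply, List.countP_append, List.countP_singleton,
            decide_eq_true_eq]
          by_cases hi : i = g c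
          · simp [hi]
          · simp [hi, Ne.symm hi]
        · simp [bucketStep, Prog.post, Expr.eval, h4, h7, h5']
          omega
        · simp [bucketStep, Prog.post, ha, harr a ha]
        · simp [bucketStep, Prog.post, h1, h2, hvar x h1 h2]
  · exact ⟨[], l, rfl, rfl, hlink, by simpa using h8, by simpa using h5, fun _ _ => rfl,
      fun _ _ _ => rfl⟩
  · simp [Expr.cost]
    omega
  · rintro s' ⟨done, rest, hl', hr, -, h⟩
    rw [List.length_eq_zero_iff] at hr
    subst hr
    rw [List.append_nil] at hl'
    rw [hl']
    exact h

theorem runs_sumLevels {w M K : ℕ} {s : State} {f F : ℕ → ℕ} (h8 : ∀ i, s.arr 8 i = f i)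
    (hF : ∀ i, F i = f i + F (i + 1)) (hFM : F (M + 1) = 0) (h5 : s.var 5 = M)
    (h6 : s.var 6 = 0) (h7 : s.var 7 = 0) (h8' : s.var 8 = 0) (h9 : s.var 9 = K)
    (hM : M ≤ w) (hw : 1 ≤ w) (hK : K ≤ w) (hFw : ∀ i, F i ≤ w)
    (hsum : ∑ i ∈ Ico 1 (M + 1), min K (F i) ≤ w) :
    Runs w sumLevels s (3 + 33 * M) fun s' =>
      (∀ i, s'.arr 8 i = if 1 ≤ i ∧ i ≤ M then 0 else f i) ∧
      s'.var 7 = ∑ i ∈ Ico 1 (M + 1), min K (F i) ∧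
      s'.var 8 = ∑ i ∈ Ico 1 (M + 1), min (K - 1) (F i) ∧
      (∀ a, a ≠ 8 → s'.arr a = s.arr a) ∧
      ∀ x, x < 5 ∨ 9 ≤ x → s'.var x = s.var x := by
  refine (Runs.loop (c := fun _ => 30) (Inv := fun m s' => m ≤ M ∧ s'.var 5 = m ∧
    (∀ i, s'.arr 8 i = if m + 1 ≤ i ∧ i ≤ M then 0 else f i) ∧ s'.var 6 = F (m + 1) ∧
    s'.var 7 = ∑ i ∈ Ico (m + 1) (M + 1), min K (F i) ∧
    s'.var 8 = ∑ i ∈ Ico (m + 1) (M + 1), min (K - 1) (F i) ∧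
    (∀ a, a ≠ 8 → s'.arr a = s.arr a) ∧
    ∀ x, x < 5 ∨ 9 ≤ x → s'.var x = s.var x) ?_ ?_ M s ?_).mono ?_ ?_
  · rintro s' ⟨-, hm, -⟩
    simp [Expr.Fits, Expr.eval, hm]
  · rintro m s' ⟨hmM, h5', h8', h6', h7', h8'', harr, hvar⟩
    have h9' : s'.var 9 = K := by rw [hvar 9 (by omega), h9]
    have hcell : s'.arr 8 (m + 1) = f (m + 1) := by rw [h8', if_neg (by omega)]
    have hFm := hF (m + 1)
    have hFw' := hFw (m + 1)
    have hIco1 := sum_eq_sum_Ico_succ_bot (show m + 1 < M + 1 by omega) fun i => min K (F i)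
    have hIco2 := sum_eq_sum_Ico_succ_bot (show m + 1 < M + 1 by omega)
      fun i => min (K - 1) (F i)
    have hsub : ∑ i ∈ Ico (m + 1) (M + 1), min K (F i) ≤ w :=
      (sum_le_sum_of_subset (Ico_subset_Ico_left (by omega))).trans hsum
    have hsub' : ∑ i ∈ Ico (m + 1) (M + 1), min (K - 1) (F i) ≤
        ∑ i ∈ Ico (m + 1) (M + 1), min K (F i) :=
      sum_le_sum fun i _ => min_le_min_right _ (Nat.sub_le _ _)
    refine ⟨by simp [Expr.Fits], by simp [Expr.Fits, h5']; omega, by simp [Expr.eval, h5'],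
      Runs.of_ok ?_ (by decide) ⟨by omega, ?_, fun i => ?_, ?_, ?_, ?_, fun a ha => ?_,
        fun x hx => ?_⟩⟩
    · simp [levelStep, Prog.Ok, Prog.post, Expr.Fits, Expr.eval, h5', h6', h7', h8'', h9', hcell]
      omega
    · simp [levelStep, Prog.post, Expr.eval, h5']
    · simp only [levelStep, Prog.post, Expr.eval, State.setVar_arr, State.setArr_arr,
        State.setVar_var, h5', h8', Function.update_apply, if_true]
      by_cases hi : i = m + 1
      · simp [hi]
        omega
      · simp [hi]
        split_ifs <;> first | rfl | omega
    · simp [levelStep, Prog.post, Expr.eval, h5', h6', hcell]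
      omega
    · simp [levelStep, Prog.post, Expr.eval, h5', h6', h7', h9', hcell]
      omega
    · simp [levelStep, Prog.post, Expr.eval, h5', h6', h8'', h9', hcell]
      omega
    · simp [levelStep, Prog.post, ha, harr a ha]
    · have h1 : x ≠ 5 ∧ x ≠ 6 ∧ x ≠ 7 ∧ x ≠ 8 := by omega
      simp [levelStep, Prog.post, hvar x hx, h1]
  · refine ⟨le_rfl, h5, fun i => ?_, by rw [h6, hFM], by simp [h7], by simp [h8'],
      fun _ _ => rfl, fun _ _ => rfl⟩
    rw [h8, if_neg (by omega)]
  · simp [Expr.cost]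
    omega
  · rintro s' ⟨-, -, h1, -, h2, h3, h4⟩
    exact ⟨h1, h2, h3, h4⟩

end RAM

namespace RAM

/-! ### The program -/

/-- Prepare the selection of the children of the vertex in variable `2`. -/
def prepare : Prog :=
  .seq (.assign 9 (.sub (.var 1) (.get 3 (.var 2))))
    (.seq (.assign 4 (.get 5 (.var 2)))
      (.seq (.assign 5 (.lit 0))
        (.seq (.assign 6 (.lit 0))
          (.seq (.assign 7 (.lit 0)) (.assign 8 (.lit 0))))))

/-- Compute the two costs of leaving out the current vertex from the sums over the levels. -/
def finish : Prog :=
  .seq (.assign 10 (.add (.sub (.get 2 (.var 2)) (.var 7)) (.sub (.var 3) (.get 4 (.var 2)))))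
    (.assign 11 (.sub (.get 2 (.var 2)) (.var 8)))

/-- The costs of leaving out the current vertex when at least `k` of its children are forced. -/
def finishForced : Prog :=
  .ite (.var 1) (.get 3 (.var 2))
    (.seq (.assign 10 (.var 3)) (.assign 11 (.var 3)))
    (.seq (.assign 10 (.add (.get 2 (.var 2)) (.sub (.var 3) (.get 4 (.var 2)))))
      (.assign 11 (.var 3)))

/-- Compute the costs of leaving out the vertex in variable `2`: variable `10` is for a parent
outside the set, variable `11` for a parent inside it. -/
def compute : Prog :=
  .ite (.get 3 (.var 2)) (.var 1)
    (.seq prepare (.seq fillBuckets (.seq sumLevels finish))) finishForced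

/-- Compute the cost of choosing the current vertex and enter its three costs into the aggregates
of its parent. The root is entered into its own aggregates, which are no longer needed then. -/
def push : Prog :=
  .seq (.assign 12 (.add (.lit 1) (.get 1 (.var 2))))
    (.seq (.assign 13 (.get 0 (.var 2)))
      (.seq (.store 1 (.var 13) (.add (.get 1 (.var 13))
          (.sub (.var 12) (.sub (.var 12) (.var 11)))))
        (.seq (.store 4 (.var 13) (.add (.get 4 (.var 13))
            (.sub (.sub (.var 3) (.sub (.var 12) (.var 10))) (.get 4 (.var 13)))))
          (.ite (.var 10) (.var 3)
            (.seq (.store 2 (.var 13) (.add (.get 2 (.var 13)) (.var 10)))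
              (.ite (.var 12) (.var 10)
                (.seq (.store 7 (.var 2) (.sub (.var 10) (.var 12)))
                  (.seq (.store 6 (.var 2) (.get 5 (.var 13)))
                    (.store 5 (.var 13) (.var 2))))
                .skip))
            (.seq (.store 2 (.var 13) (.add (.get 2 (.var 13)) (.var 12)))
              (.store 3 (.var 13) (.add (.get 3 (.var 13)) (.lit 1))))))))

/-- Process the vertices from the last one to the root. For every vertex `v` that is still to be
processed, arrays `1` to `4` hold the sum in `costIn`, `baseCost`, `numForced` and `slack` of the
processed children of `v`, and array `5` the head of the linked list of those with positive gain.
The links are in array `6` and the gains in array `7`; array `8` holds the buckets. Variables `0`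
to `3` hold `n`, `k`, the current vertex and `n + 1`, and variables `10` to `13` the costs `B`, `D`,
`A` of the current vertex and its parent. -/
def quasiperfectProg : Prog :=
  .seq (.seq (.assign 3 (.add (.var 0) (.lit 1))) (.assign 2 (.var 0)))
    (.seq (.loop (.lit 0) (.var 2)
        (.seq (.assign 2 (.sub (.var 2) (.lit 1))) (.seq compute push)))
      (.assign 0 (.sub (.var 10) (.sub (.var 10) (.var 12)))))

/-! ### The costs of a vertex are computed correctly -/

theorem countP_eq_card_filter {l : List ℕ} (hl : l.Nodup) (P : ℕ → Prop) [DecidablePred P] :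
    l.countP (fun c => P c) = #{c ∈ l.toFinset | P c} := by
  rw [List.countP_eq_length_filter, ← List.toFinset_card_of_nodup (hl.filter _),
    List.toFinset_filter]
  simp

theorem runs_compute {w N k v : ℕ} {a b : ℕ → ℕ} {C : Finset ℕ} {l : List ℕ} {s : State}
    (h1 : s.var 1 = k) (h2 : s.var 2 = v) (h3 : s.var 3 = N)
    (hS : s.arr 2 v = baseCost N a b C) (hI : s.arr 3 v = numForced N b C)
    (hG : s.arr 4 v = slack N a b C) (hlink : IsLinked (s.arr 6) (s.arr 5 v) l)
    (hnd : l.Nodup) (hl : l.toFinset = {c ∈ C | 0 < gain N a b c})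
    (h7 : ∀ c ∈ l, s.arr 7 c = gain N a b c) (h8 : ∀ i, s.arr 8 i = 0)
    (hvN : v ≤ N) (hSN : baseCost N a b C ≤ N) (hCN : #C + 1 ≤ N) (hlN : ∀ c ∈ l, c ≤ N)
    (hw : 2 * N + k ≤ w) :
    Runs w compute s (60 + 21 * l.length + 33 * bucketRange N k a b C) fun s' =>
      s'.var 10 = costOut N k a b C ∧ s'.var 11 = costDom N k a b C ∧
      (∀ i, s'.arr 8 i = 0) ∧ (∀ i, i ≠ 8 → s'.arr i = s.arr i) ∧
      ∀ x, x < 4 → s'.var x = s.var x := by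
  have hIN : numForced N b C ≤ #C := card_filter_le _ _
  have hGN : slack N a b C ≤ N := slack_le
  have hlen : l.length ≤ #C := by
    rw [← List.toFinset_card_of_nodup hnd, hl]
    exact card_filter_le _ _
  have hgN : ∀ c, gain N a b c ≤ N := fun c => by
    unfold gain
    split_ifs <;> omega
  have hsup : l.toFinset.sup (gain N a b) = C.sup (gain N a b) := by
    rw [hl]
    refine le_antisymm (sup_mono (filter_subset _ _)) (Finset.sup_le fun c hc => ?_)
    rcases Nat.eq_zero_or_pos (gain N a b c) with h0 | h0
    · omega
    · exact le_sup (f := gain N a b) (mem_filter.2 ⟨hc, h0⟩)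
  have hcount : ∀ i, 1 ≤ i → l.countP (i ≤ gain N a b ·) = #{c ∈ C | i ≤ gain N a b c} := by
    intro i hi
    rw [countP_eq_card_filter hnd, hl, filter_filter]
    congr 1
    refine filter_congr fun c _ => ?_
    omega
  have htop : ∀ j, ∑ i ∈ Ico 1 (C.sup (gain N a b) + 1),
      min j (l.countP (i ≤ gain N a b ·)) = topSum C (gain N a b) j := by
    intro j
    refine sum_congr ?_ fun i hi => by rw [hcount i (mem_Ico.1 hi).1]
    ext i
    simp only [mem_Ico, mem_Icc]
    omega
  unfold compute
  refine (Runs.ite (c := 51 + 21 * l.length + 33 * bucketRange N k a b C)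
    ?_ ?_ (fun hlt => ?_) fun hlt => ?_).mono (by simp only [Expr.cost]; omega) fun _ h => h
  · simp [Expr.Fits, Expr.eval, h2, hI]
    omega
  · simp [Expr.Fits, h1]
    omega
  · simp only [Expr.eval, h1, h2, hI] at hlt
    have hM : bucketRange N k a b C = C.sup (gain N a b) := if_pos hlt
    rw [hM]
    have hMN : C.sup (gain N a b) ≤ N := Finset.sup_le fun c _ => hgN c
    have hpost : ∀ i, (prepare.post s).arr i = s.arr i := fun i => by simp [prepare, Prog.post]
    have hpvar : ∀ x, x < 4 → (prepare.post s).var x = s.var x := fun x hx => by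
      have : x ≠ 4 ∧ x ≠ 5 ∧ x ≠ 6 ∧ x ≠ 7 ∧ x ≠ 8 ∧ x ≠ 9 := by omega
      simp [prepare, Prog.post, this]
    refine (Runs.seq (c₁ := 17) (Q' := fun s' => s' = prepare.post s)
      (Runs.of_ok ?_ (by decide) rfl)
      (c₂ := 26 + 21 * l.length + 33 * C.sup (gain N a b)) ?_).mono (by omega) fun _ h => h
    · have := hlink.le hlN
      simp [prepare, Prog.Ok, Prog.post, Expr.Fits, Expr.eval, h1, h2, hI]
      omega
    rintro _ rfl
    refine (Runs.seq (runs_fillBuckets (g := gain N a b) (l := l) ?_ ?_ ?_ ?_ ?_ ?_ ?_)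
      (c₂ := 23 + 33 * C.sup (gain N a b)) ?_).mono (by omega) fun _ h => h
    · simpa [prepare, Prog.post, Expr.eval, h2] using hlink
    · simpa [hpost] using h7
    · simpa [hpost] using h8
    · simp [prepare, Prog.post, Expr.eval]
    · omega
    · exact fun c hc => (hlN c hc).trans (by omega)
    · exact fun c hc => (hgN c).trans (by omega)
    rintro s₂ ⟨hb8, hb5, hbarr, hbvar⟩
    have hF : ∀ i, l.countP (i ≤ gain N a b ·) =
        l.countP (gain N a b · = i) + l.countP (i + 1 ≤ gain N a b ·) := by
      intro i
      rw [countP_eq_card_filter hnd, countP_eq_card_filter hnd, countP_eq_card_filter hnd,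
        ← card_union_of_disjoint]
      · congr 1
        ext c
        simp only [mem_union, mem_filter, ← and_or_left]
        refine and_congr_right fun _ => ?_
        omega
      · rw [disjoint_left]
        intro c hc hc'
        simp only [mem_filter] at hc hc'
        omega
    refine (Runs.seq (runs_sumLevels (M := C.sup (gain N a b)) (K := k - numForced N b C) hb8 hF
      ?_ ?_ ?_ ?_ ?_ ?_ ?_ ?_ ?_ ?_ ?_) (c₂ := 20) ?_).mono (by omega) fun _ h => h
    · rw [List.countP_eq_zero]
      intro c hc
      have hcC : c ∈ C := by
        have := List.mem_toFinset.2 hc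
        rw [hl, mem_filter] at this
        exact this.1
      have := le_sup (f := gain N a b) hcC
      simp
      omega
    · rw [hb5, hsup]
    · rw [hbvar 6 (by decide) (by decide)]
      simp [prepare, Prog.post, Expr.eval]
    · rw [hbvar 7 (by decide) (by decide)]
      simp [prepare, Prog.post, Expr.eval]
    · rw [hbvar 8 (by decide) (by decide)]
      simp [prepare, Prog.post, Expr.eval]
    · rw [hbvar 9 (by decide) (by decide)]
      simp [prepare, Prog.post, Expr.eval, h1, h2, hI]
    · omega
    · omega
    · omega
    · intro i
      have := List.countP_le_length (p := fun c => decide (i ≤ gain N a b c)) (l := l)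
      omega
    · have := topSum_gain_le_baseCost (N := N) (a := a) (b := b) (C := C) (k - numForced N b C)
      rw [htop]
      omega
    rintro s₃ ⟨hs8, hs7, hs8', hsarr, hsvar⟩
    have hvar : ∀ x, x < 4 → s₃.var x = s.var x := fun x hx => by
      rw [hsvar x (by omega), hbvar x (by omega) (by omega), hpvar x hx]
    have harr : ∀ i, i ≠ 8 → s₃.arr i = s.arr i := fun i hi => by
      rw [hsarr i hi, hbarr i hi, hpost]
    rw [htop] at hs7 hs8'
    have hv2 : s₃.var 2 = v := by rw [hvar 2 (by decide), h2]
    have hv3 : s₃.var 3 = N := by rw [hvar 3 (by decide), h3]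
    have ha2 : s₃.arr 2 v = baseCost N a b C := by rw [harr 2 (by decide), hS]
    have ha4 : s₃.arr 4 v = slack N a b C := by rw [harr 4 (by decide), hG]
    have hT := topSum_gain_le_baseCost (N := N) (a := a) (b := b) (C := C) (k - numForced N b C)
    have hT' := topSum_gain_le_baseCost (N := N) (a := a) (b := b) (C := C)
      (k - numForced N b C - 1)
    refine Runs.of_ok ?_ (by decide) ⟨?_, ?_, fun i => ?_, fun i hi => ?_, fun x hx => ?_⟩
    · simp [finish, Prog.Ok, Prog.post, Expr.Fits, Expr.eval, hv2, hv3, ha2, ha4, hs7, hs8']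
      omega
    · rw [costOut, if_neg (by omega)]
      simp [finish, Prog.post, Expr.eval, hv2, hv3, ha2, ha4, hs7]
    · rw [costDom, if_pos hlt]
      simp [finish, Prog.post, Expr.eval, hv2, ha2, hs8']
    · simp only [finish, Prog.post, State.setVar_arr, hs8]
      split_ifs with hi
      · rfl
      · -- The bucket is empty because the gains in the list are positive and bounded.
        rw [List.countP_eq_zero]
        intro c hc
        have hcC := List.mem_toFinset.2 hc
        rw [hl, mem_filter] at hcC
        have := le_sup (f := gain N a b) hcC.1
        simp
        omega
    · simp [finish, Prog.post, harr i hi]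
    · have : x ≠ 10 ∧ x ≠ 11 := by omega
      simp [finish, Prog.post, this, hvar x hx]
  · simp only [Expr.eval, h1, h2, hI] at hlt
    refine Runs.of_ok ?_ (le_trans (b := 51) (by decide) (by omega))
      ⟨?_, ?_, fun i => ?_, fun i hi => ?_, fun x hx => ?_⟩
    · simp [finishForced, Prog.Ok, Prog.post, Expr.Fits, Expr.eval, h1, h2, h3, hS, hG, hI]
      omega
    · rw [costOut]
      simp only [finishForced, Prog.post, Expr.eval, h1, h2, hI]
      split_ifs
      · simp [h3]
      · have hK : k - numForced N b C = 0 := by omega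
        simp [h3, hS, hG, hK, topSum_zero]
    · rw [costDom, if_neg hlt]
      simp only [finishForced, Prog.post, Expr.eval, h1, h2, hI]
      split_ifs <;> simp [h3]
    · simp only [finishForced, Prog.post]
      split_ifs <;> simp [h8]
    · simp only [finishForced, Prog.post]
      split_ifs <;> simp
    · have : x ≠ 10 ∧ x ≠ 11 := by omega
      simp only [finishForced, Prog.post]
      split_ifs <;> simp [this]

/-! ### The main loop -/

/-- The children of `q` with number at least `j`. -/
def processed (n : ℕ) (p : ℕ → ℕ) (j q : ℕ) : Finset ℕ := {c ∈ Ico j n | p c = q}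

theorem processed_of_eq {n v : ℕ} {p : ℕ → ℕ} (hv : v < n) :
    processed n p v (p v) = insert v (processed n p (v + 1) (p v)) ∧
      v ∉ processed n p (v + 1) (p v) := by
  constructor
  · ext c
    simp only [processed, mem_insert, mem_filter, mem_Ico]
    constructor
    · rintro ⟨⟨h1, h2⟩, h3⟩
      rcases eq_or_lt_of_le h1 with h | h
      · exact Or.inl h.symm
      · exact Or.inr ⟨⟨h, h2⟩, h3⟩
    · rintro (rfl | ⟨⟨h1, h2⟩, h3⟩)
      · exact ⟨⟨le_rfl, hv⟩, rfl⟩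
      · exact ⟨⟨by omega, h2⟩, h3⟩
  · simp [processed]

theorem processed_of_ne {n v q : ℕ} {p : ℕ → ℕ} (hq : q ≠ p v) :
    processed n p v q = processed n p (v + 1) q := by
  ext c
  simp only [processed, mem_filter, mem_Ico]
  constructor
  · rintro ⟨⟨h1, h2⟩, rfl⟩
    rcases eq_or_lt_of_le h1 with h | h
    · exact absurd (h ▸ rfl) hq
    · exact ⟨⟨h, h2⟩, rfl⟩
  · rintro ⟨⟨h1, h2⟩, h3⟩
    exact ⟨⟨by omega, h2⟩, h3⟩

theorem processed_subset_children {n v q : ℕ} {p : ℕ → ℕ}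
    (hp : ∀ j, 0 < j → j < n → p j < j) : processed n p (v + 1) q ⊆ children n p q := by
  intro c hc
  simp only [processed, mem_filter, mem_Ico] at hc
  have := hp c (by omega) hc.1.2
  exact mem_children.2 ⟨by omega, hc.1.2, hc.2⟩

/-- The children of `q` with number at least `j` and positive gain, in increasing order. -/
def gainers (n : ℕ) (p A B : ℕ → ℕ) (j q : ℕ) : List ℕ :=
  (List.range' j (n - j)).filter fun c => p c = q ∧ 0 < gain (n + 1) A B c

theorem mem_gainers {n j q c : ℕ} {p A B : ℕ → ℕ} :
    c ∈ gainers n p A B j q ↔ (j ≤ c ∧ c < n) ∧ p c = q ∧ 0 < gain (n + 1) A B c := by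
  simp only [gainers, List.mem_filter, List.mem_range'_1, decide_eq_true_eq]
  refine and_congr_left fun _ => ?_
  omega

theorem gainers_succ {n v q : ℕ} {p A B : ℕ → ℕ} (hv : v < n) :
    gainers n p A B v q = if p v = q ∧ 0 < gain (n + 1) A B v then
      v :: gainers n p A B (v + 1) q else gainers n p A B (v + 1) q := by
  unfold gainers
  rw [show n - v = n - (v + 1) + 1 by omega, List.range'_succ, List.filter_cons]
  simp only [decide_eq_true_eq]

theorem gainers_nodup {n j q : ℕ} {p A B : ℕ → ℕ} : (gainers n p A B j q).Nodup :=
  List.Nodup.filter _ List.nodup_range'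

theorem toFinset_gainers {n j q : ℕ} {p A B : ℕ → ℕ} :
    (gainers n p A B j q).toFinset = {c ∈ processed n p j q | 0 < gain (n + 1) A B c} := by
  ext c
  rw [List.mem_toFinset, mem_gainers, processed, mem_filter, mem_filter, mem_Ico,
    and_assoc (b := p c = q)]

/-- The state of the memory before the vertices below `j` are processed. -/
structure LoopInv (n k : ℕ) (p A B D : ℕ → ℕ) (j : ℕ) (s : State) : Prop where
  le : j ≤ n
  var_zero : s.var 0 = n
  var_one : s.var 1 = k
  var_two : s.var 2 = j
  var_three : s.var 3 = n + 1
  parent : ∀ i, s.arr 0 i = if 0 < i ∧ i < n then p i else 0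
  sumIn : ∀ q < j, s.arr 1 q = ∑ c ∈ processed n p j q, min (A c) (D c)
  base : ∀ q < j, s.arr 2 q = baseCost (n + 1) A B (processed n p j q)
  forced : ∀ q < j, s.arr 3 q = numForced (n + 1) B (processed n p j q)
  slack : ∀ q < j, s.arr 4 q = slack (n + 1) A B (processed n p j q)
  link : ∀ q < j, IsLinked (s.arr 6) (s.arr 5 q) (gainers n p A B j q)
  gain : ∀ c, j ≤ c → c < n → 0 < gain (n + 1) A B c → s.arr 7 c = gain (n + 1) A B c
  empty : ∀ i, s.arr 8 i = 0
  current : j < n → s.var 12 = A j ∧ s.var 10 = B j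

/-- The effect of `push`. -/
theorem post_push {s : State} {v q N a b d : ℕ} (h2 : s.var 2 = v) (h3 : s.var 3 = N)
    (h10 : s.var 10 = b) (h11 : s.var 11 = d) (ha : 1 + s.arr 1 v = a) (hq : s.arr 0 v = q) :
    (∀ x, x < 4 ∨ x = 10 → (push.post s).var x = s.var x) ∧ (push.post s).var 12 = a ∧
    (push.post s).arr 0 = s.arr 0 ∧
    (push.post s).arr 1 = Function.update (s.arr 1) q (s.arr 1 q + min a d) ∧
    (push.post s).arr 2 = Function.update (s.arr 2) q (s.arr 2 q + if b < N then b else a) ∧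
    (push.post s).arr 3 = Function.update (s.arr 3) q (s.arr 3 q + if b < N then 0 else 1) ∧
    (push.post s).arr 4 = Function.update (s.arr 4) q (max (N - (a - b)) (s.arr 4 q)) ∧
    (push.post s).arr 5 =
      (if b < N ∧ a < b then Function.update (s.arr 5) q v else s.arr 5) ∧
    (push.post s).arr 6 =
      (if b < N ∧ a < b then Function.update (s.arr 6) v (s.arr 5 q) else s.arr 6) ∧
    (push.post s).arr 7 =
      (if b < N ∧ a < b then Function.update (s.arr 7) v (b - a) else s.arr 7) ∧
    (push.post s).arr 8 = s.arr 8 := by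
  have hmin : a - (a - d) = min a d := by omega
  have hmax : s.arr 4 q + (N - (a - b) - s.arr 4 q) = max (N - (a - b)) (s.arr 4 q) := by omega
  have hx : ∀ x, x < 4 ∨ x = 10 → x ≠ 12 ∧ x ≠ 13 := fun x hx => by omega
  by_cases hb : b < N
  · by_cases hab : a < b
    · refine ⟨fun x h => ?_, ?_, ?_, ?_, ?_, ?_, ?_, ?_, ?_, ?_, ?_⟩ <;>
        simp [push, Prog.post, Expr.eval, h2, h3, h10, h11, ha, hq, hmin, hmax, hb, hab]
      simp [hx x h]
    · refine ⟨fun x h => ?_, ?_, ?_, ?_, ?_, ?_, ?_, ?_, ?_, ?_, ?_⟩ <;>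
        simp [push, Prog.post, Expr.eval, h2, h3, h10, h11, ha, hq, hmin, hmax, hb, hab]
      simp [hx x h]
  · refine ⟨fun x h => ?_, ?_, ?_, ?_, ?_, ?_, ?_, ?_, ?_, ?_, ?_⟩ <;>
      simp [push, Prog.post, Expr.eval, h2, h3, h10, h11, ha, hq, hmin, hmax, hb]
    simp [hx x h]

theorem ok_push {s : State} {w v q N a b d : ℕ} (h2 : s.var 2 = v) (h3 : s.var 3 = N)
    (h10 : s.var 10 = b) (h11 : s.var 11 = d) (ha : 1 + s.arr 1 v = a) (hq : s.arr 0 v = q)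
    (hv : v ≤ N) (hqN : q ≤ N) (haN : a ≤ N) (hbN : b ≤ N) (hdN : d ≤ N)
    (h1q : s.arr 1 q ≤ N) (h2q : s.arr 2 q ≤ N) (h3q : s.arr 3 q ≤ N) (h4q : s.arr 4 q ≤ N)
    (h5q : s.arr 5 q ≤ N) (hw : 2 * N ≤ w) (hN : 1 ≤ N) : push.Ok w s := by
  by_cases hb : b < N
  · by_cases hab : a < b
    · simp [push, Prog.Ok, Prog.post, Expr.Fits, Expr.eval, h2, h3, h10, h11, ha, hq, hb, hab]
      omega
    · simp [push, Prog.Ok, Prog.post, Expr.Fits, Expr.eval, h2, h3, h10, h11, ha, hq, hb, hab]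
      omega
  · simp [push, Prog.Ok, Prog.post, Expr.Fits, Expr.eval, h2, h3, h10, h11, ha, hq, hb]
    omega

end RAM

namespace RAM

variable {n k : ℕ} {p A B D : ℕ → ℕ}

theorem loopInv_push (h : IsCostTable n k p A B D) {v : ℕ} (hv : v < n)
    {s : State} (h0 : s.var 0 = n) (h1 : s.var 1 = k) (h2 : s.var 2 = v) (h3 : s.var 3 = n + 1)
    (h10 : s.var 10 = B v) (h11 : s.var 11 = D v)
    (hpar : ∀ i, s.arr 0 i = if 0 < i ∧ i < n then p i else 0)
    (hS1 : ∀ q < v + 1, s.arr 1 q = ∑ c ∈ processed n p (v + 1) q, min (A c) (D c))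
    (hS2 : ∀ q < v + 1, s.arr 2 q = baseCost (n + 1) A B (processed n p (v + 1) q))
    (hS3 : ∀ q < v + 1, s.arr 3 q = numForced (n + 1) B (processed n p (v + 1) q))
    (hS4 : ∀ q < v + 1, s.arr 4 q = slack (n + 1) A B (processed n p (v + 1) q))
    (hlink : ∀ q < v + 1, IsLinked (s.arr 6) (s.arr 5 q) (gainers n p A B (v + 1) q))
    (h7 : ∀ c, v + 1 ≤ c → c < n → 0 < gain (n + 1) A B c → s.arr 7 c = gain (n + 1) A B c)
    (h8 : ∀ i, s.arr 8 i = 0) : LoopInv n k p A B D v (push.post s) := by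
  have hA : 1 + s.arr 1 v = A v := by
    rw [hS1 v (Nat.lt_succ_self v), h.eq_in v hv]
    rfl
  obtain ⟨pv, p12, p0, p1, p2, p3, p4, p5, p6, p7, p8⟩ :=
    post_push h2 h3 h10 h11 hA rfl
  have hroot : ∀ q < v, s.arr 0 v = p v := fun q hq => by
    rw [hpar, if_pos ⟨by omega, hv⟩]
  have hgain : (B v < n + 1 ∧ A v < B v) ↔ 0 < gain (n + 1) A B v := by
    unfold gain
    split_ifs <;> omega
  have hgain' : 0 < gain (n + 1) A B v → B v - A v = gain (n + 1) A B v := by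
    unfold gain
    split_ifs <;> omega
  simp only [hgain] at p5 p6 p7
  refine ⟨hv.le, by rw [pv 0 (by decide), h0], by rw [pv 1 (by decide), h1],
    by rw [pv 2 (by decide), h2], by rw [pv 3 (by decide), h3], fun i => by rw [p0, hpar],
    fun q hq => ?_, fun q hq => ?_, fun q hq => ?_, fun q hq => ?_, fun q hq => ?_,
    fun c hc hcn hg => ?_, fun i => by rw [p8, h8],
    fun _ => ⟨p12, by rw [pv 10 (by decide), h10]⟩⟩
  · rw [p1, hroot q hq, Function.update_apply]
    split_ifs with hqp
    · subst hqp
      obtain ⟨e1, e2⟩ := processed_of_eq (p := p) hv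
      rw [e1, sum_insert e2, hS1 _ (by omega), add_comm]
    · rw [processed_of_ne hqp, hS1 q (by omega)]
  · rw [p2, hroot q hq, Function.update_apply]
    split_ifs with hqp
    all_goals first
      | rw [processed_of_ne hqp, hS2 q (by omega)]
      | subst hqp
        obtain ⟨e1, e2⟩ := processed_of_eq (p := p) hv
        rw [e1, baseCost, sum_insert e2, ← baseCost, hS2 _ (by omega), add_comm]
        simp [*]
  · rw [p3, hroot q hq, Function.update_apply]
    split_ifs with hqp hb
    · subst hqp
      obtain ⟨e1, e2⟩ := processed_of_eq (p := p) hv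
      rw [e1, numForced, filter_insert, if_neg (not_not.2 hb), hS3 _ (by omega)]
      rfl
    · subst hqp
      obtain ⟨e1, e2⟩ := processed_of_eq (p := p) hv
      rw [e1, numForced, filter_insert, if_pos hb,
        card_insert_of_notMem fun hmem => e2 (mem_filter.1 hmem).1, hS3 _ (by omega)]
      rfl
    · rw [processed_of_ne hqp, hS3 q (by omega)]
  · rw [p4, hroot q hq, Function.update_apply]
    split_ifs with hqp
    · subst hqp
      obtain ⟨e1, -⟩ := processed_of_eq (p := p) hv
      rw [e1, _root_.slack, sup_insert, hS4 _ (by omega)]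
      rfl
    · rw [processed_of_ne hqp, hS4 q (by omega)]
  · rw [p5, p6, hroot q hq, gainers_succ hv]
    have hnot : ∀ q', ∀ c ∈ gainers n p A B (v + 1) q', c ≠ v := fun q' c hc => by
      rw [mem_gainers] at hc
      omega
    have hold := hlink q (by omega)
    by_cases hg : 0 < gain (n + 1) A B v
    · simp only [hg, if_true, and_true]
      have hold' : IsLinked (Function.update (s.arr 6) v (s.arr 5 (p v))) (s.arr 5 q)
          (gainers n p A B (v + 1) q) :=
        hold.congr fun c hc => (Function.update_of_ne (hnot q c hc) _ _).symm
      split_ifs with hqp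
      · subst hqp
        rw [Function.update_self]
        exact ⟨rfl, by omega, by rwa [Function.update_self]⟩
      · rwa [Function.update_of_ne (Ne.symm hqp)]
    · simpa only [hg, if_false, and_false] using hold
  · rw [p7]
    rcases eq_or_lt_of_le hc with rfl | hlt
    · rw [if_pos hg, Function.update_self, hgain' hg]
    · split_ifs
      · rw [Function.update_of_ne (by omega), h7 c hlt hcn hg]
      · exact h7 c hlt hcn hg

/-- One round of the main loop takes time proportional to the number of children of the vertex plus
its bucket range. -/
theorem runs_round (h : IsCostTable n k p A B D) (hk : 1 ≤ k)
    (hp : ∀ j, 0 < j → j < n → p j < j) {w : ℕ} (hw : 2 * (n + 1) + k ≤ w) {v : ℕ} {s : State}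
    (hs : LoopInv n k p A B D (v + 1) s) :
    Runs w (.seq (.assign 2 (.sub (.var 2) (.lit 1))) (.seq compute push)) s
      (164 + 21 * #(children n p v) + 33 * bucketRange (n + 1) k A B (children n p v))
      (LoopInv n k p A B D v) := by
  have hv : v < n := hs.le
  have hAle := (h.bounds hk hp v hv).1
  have hBle := h.out_le hk hp hv
  have hDle := h.dom_le hk hp hv
  have hcard : ∀ q, #(children n p q) + 1 ≤ n := fun q => by
    have : children n p q ⊆ Ico 1 n := fun c hc => by
      rw [mem_children] at hc
      exact mem_Ico.2 ⟨by omega, hc.2.1⟩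
    have := card_le_card this
    rw [Nat.card_Ico] at this
    omega
  have hlen : (gainers n p A B (v + 1) v).length ≤ #(children n p v) := by
    rw [← List.toFinset_card_of_nodup gainers_nodup, toFinset_gainers]
    exact card_filter_le _ _
  have hgl : ∀ q, ∀ c ∈ gainers n p A B (v + 1) q, c ≤ n + 1 := fun q c hc => by
    rw [mem_gainers] at hc
    omega
  have hvv := Nat.lt_succ_self v
  let s₁ := s.setVar 2 v
  refine (Runs.seq (c₁ := 4) (Q' := fun s' => s' = s₁) (Runs.of_ok ?_ (by decide) ?_)
    (c₂ := 160 + 21 * #(children n p v) + 33 * bucketRange (n + 1) k A B (children n p v))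
    ?_).mono (by omega) fun _ h => h
  · simp [Prog.Ok, Expr.Fits, hs.var_two]
    omega
  · simp [Prog.post, Expr.eval, hs.var_two, s₁]
  rintro _ rfl
  have hs₁ : ∀ x, x ≠ 2 → s₁.var x = s.var x := fun x hx => by simp [s₁, hx]
  refine Runs.mono (c := 60 + 21 * (gainers n p A B (v + 1) v).length +
      33 * bucketRange (n + 1) k A B (children n p v) + 100)
    (Runs.seq (runs_compute (k := k) (v := v) (N := n + 1) (a := A) (b := B)
    (C := children n p v) (l := gainers n p A B (v + 1) v) ?_ ?_ ?_ (hs.base v hvv)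
    (hs.forced v hvv) (hs.slack v hvv) (hs.link v hvv) gainers_nodup toFinset_gainers ?_
    hs.empty ?_ ?_ ?_ ?_ hw) ?_) (by omega) fun _ h => h
  · rw [hs₁ 1 (by decide), hs.var_one]
  · simp [s₁]
  · rw [hs₁ 3 (by decide), hs.var_three]
  · intro c hc
    rw [mem_gainers] at hc
    exact hs.gain c hc.1.1 hc.1.2 hc.2.2
  · omega
  · have := (h.baseCost_le hk hp hv).1
    omega
  · have := hcard v
    omega
  · exact hgl v
  rintro s₂ ⟨c10, c11, c8, carr, cvar⟩
  have e0 : s₂.var 0 = n := by rw [cvar 0 (by decide), hs₁ 0 (by decide), hs.var_zero]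
  have e1 : s₂.var 1 = k := by rw [cvar 1 (by decide), hs₁ 1 (by decide), hs.var_one]
  have e2 : s₂.var 2 = v := by rw [cvar 2 (by decide)]; simp [s₁]
  have e3 : s₂.var 3 = n + 1 := by rw [cvar 3 (by decide), hs₁ 3 (by decide), hs.var_three]
  rw [← h.eq_out v hv] at c10
  rw [← h.eq_dom v hv] at c11
  have carr' : ∀ i, i ≠ 8 → s₂.arr i = s.arr i := carr
  have hA : 1 + s₂.arr 1 v = A v := by
    rw [carr' 1 (by decide), hs.sumIn v hvv, h.eq_in v hv]
    rfl
  have hq : s.arr 0 v < v + 1 := by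
    rw [hs.parent]
    split_ifs with h0
    · have := hp v h0.1 h0.2
      omega
    · omega
  have hqn : s.arr 0 v < n := by omega
  have hsub : processed n p (v + 1) (s.arr 0 v) ⊆ children n p (s.arr 0 v) :=
    processed_subset_children hp
  obtain ⟨b1, b2⟩ := h.baseCost_le hk hp hqn
  refine Runs.of_ok (ok_push e2 e3 c10 c11 hA rfl (by omega) ?_ (by omega) (by omega) (by omega)
    ?_ ?_ ?_ ?_ ?_ (by omega) (by omega)) (by decide)
    (loopInv_push h hv e0 e1 e2 e3 c10 c11 ?_ ?_ ?_ ?_ ?_ ?_ ?_ c8)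
  · rw [carr' 0 (by decide)]
    omega
  · rw [carr' 0 (by decide), carr' 1 (by decide), hs.sumIn _ hq]
    exact (sum_le_sum_of_subset hsub).trans (by omega)
  · rw [carr' 0 (by decide), carr' 2 (by decide), hs.base _ hq]
    exact (sum_le_sum_of_subset hsub).trans (b1.trans (by omega))
  · rw [carr' 0 (by decide), carr' 3 (by decide), hs.forced _ hq]
    have := hcard (s.arr 0 v)
    exact (card_filter_le _ _).trans ((card_le_card hsub).trans (by omega))
  · rw [carr' 0 (by decide), carr' 4 (by decide), hs.slack _ hq]
    exact slack_le
  · rw [carr' 0 (by decide), carr' 5 (by decide)]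
    exact (hs.link _ hq).le (hgl _)
  · rw [carr' 0 (by decide)]
    exact hs.parent
  · rw [carr' 1 (by decide)]
    exact hs.sumIn
  · rw [carr' 2 (by decide)]
    exact hs.base
  · rw [carr' 3 (by decide)]
    exact hs.forced
  · rw [carr' 4 (by decide)]
    exact hs.slack
  · rw [carr' 5 (by decide), carr' 6 (by decide)]
    exact hs.link
  · rw [carr' 7 (by decide)]
    exact hs.gain

theorem runs_quasiperfectProg (h : IsCostTable n k p A B D) (hk : 1 ≤ k) (hn : 0 < n)
    (hp : ∀ j, 0 < j → j < n → p j < j) {w : ℕ} (hw : 2 * (n + 1) + k ≤ w) :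
    Runs w quasiperfectProg (input n k p) (300 * n) fun s => s.var 0 = min (A 0) (B 0) := by
  have hcost : ∑ v ∈ range n, (164 + 21 * #(children n p v) +
      33 * bucketRange (n + 1) k A B (children n p v)) ≤ 251 * n := by
    have h1 := h.sum_bucketRange_le hk hp
    have h2 : ∑ v ∈ range n, #(children n p v) = n - 1 := by
      simp_rw [card_eq_sum_ones]
      rw [sum_sum_children hp, ← card_eq_sum_ones, Nat.card_Ico]
    rw [sum_add_distrib, sum_add_distrib, ← mul_sum, ← mul_sum, h2, sum_const, card_range,
      smul_eq_mul]
    omega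
  let s₁ := ((input n k p).setVar 3 (n + 1)).setVar 2 n
  have hs₁ : LoopInv n k p A B D n s₁ := by
    have hempty : ∀ q, processed n p n q = ∅ := by simp [processed]
    refine ⟨le_rfl, rfl, rfl, rfl, rfl, fun i => by simp [s₁, input], fun q _ => ?_,
      fun q _ => ?_, fun q _ => ?_, fun q _ => ?_, fun q _ => ?_, fun c hc hcn => by omega,
      fun i => by simp [s₁, input], fun hlt => by omega⟩
    · simp [hempty, s₁, input]
    · simp [hempty, s₁, input, baseCost]
    · simp [hempty, s₁, input, numForced]
    · simp [hempty, s₁, input, slack]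
    · simp [gainers, s₁, input, IsLinked]
  refine (Runs.seq (c₁ := 6) (Q' := fun s' => s' = s₁) (Runs.of_ok ?_ (by decide) ?_)
    (c₂ := 6 + (n + 1) * 3 + 251 * n) ?_).mono (by omega) fun _ h => h
  · simp [Prog.Ok, Prog.post, Expr.Fits, Expr.eval, input]
    omega
  · simp [Prog.post, Expr.eval, input, s₁]
  rintro _ rfl
  refine (Runs.seq (Runs.loop (Inv := LoopInv n k p A B D)
    (c := fun v => 164 + 21 * #(children n p v) +
      33 * bucketRange (n + 1) k A B (children n p v)) ?_ ?_ n s₁ hs₁)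
    (c₂ := 6) ?_).mono ?_ fun _ h => h
  · intro s hs
    simp [Expr.Fits, Expr.eval, hs.var_two]
  · intro m s hs
    have := hs.le
    refine ⟨by simp [Expr.Fits], ?_, by simp [Expr.eval, hs.var_two], runs_round h hk hp hw hs⟩
    simp [Expr.Fits, hs.var_two]
    omega
  · intro s hs
    obtain ⟨h12, h10⟩ := hs.current hn
    have hA := (h.bounds hk hp 0 hn).1
    have hB := h.out_le hk hp hn
    refine Runs.of_ok ?_ (by decide) ?_
    · simp [Prog.Ok, Expr.Fits, h12, h10]
      omega
    · simp [Prog.post, Expr.eval, h12, h10]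
      omega
  · simp only [Expr.cost]
    omega

end RAM

/-! ### Linear time -/

theorem mainTheorem4 :
    ∃ (P : RAM.Prog) (C : ℕ), ∀ (V : Type*) [Finite V] (T : SimpleGraph V), T.IsTree →
      (∃ (num : Fin (Nat.card V) ≃ V) (p : ℕ → ℕ), IsParentArray T num p) ∧
      ∀ (k n : ℕ) (num : Fin n ≃ V) (p : ℕ → ℕ), 1 ≤ k → IsParentArray T num p →
        ∃ (t : ℕ) (s : RAM.State),
          RAM.Exec (C * (n + k)) P (RAM.input n k p) t s ∧
          t ≤ C * n ∧
          RAM.output s = quasiperfectDominationNumber T k := by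
  refine ⟨RAM.quasiperfectProg, 300, fun V _ T hT =>
    ⟨hT.exists_isParentArray, fun k n num p hk hpar => ?_⟩⟩
  have hn : 0 < n := by
    obtain ⟨r⟩ := hT.connected.nonempty
    exact Fin.pos (num.symm r)
  obtain ⟨A, B, D, h⟩ := exists_isCostTable n k p
  obtain ⟨t, s, hexec, ht, hs⟩ :=
    RAM.runs_quasiperfectProg h hk hn hpar.1 (w := 300 * (n + k)) (by omega)
  exact ⟨t, s, hexec, ht, hs.trans (quasiperfectDominationNumber_eq hpar hn hk h).symm⟩
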